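/- **Setting.** Write $\overline f(s)=\overline{f(\overline s)}$. The extended Selberg class $\mathcal S^\sharp$ consists of the not identically vanishing Dirichlet series $F(s)=\sum_{n\ge1}a(n)n^{-s}$, absolutely convergent for $\Re s>1$, such that $(s-1)^mF(s)$ continues to an entire function of finite order for some integer $m\ge 0$, and which satisfy a functional equation $$\gamma(s)F(s)=\omega\,\overline{\gamma}(1-s)\overline F(1-s),\qquad \gamma(s)=Q^s\prod_{j=1}^r\Gamma(\lambda_js+\mu_j),\qquad(1)$$ with $|\omega|=1$, $Q>0$, $r\ge0$, $\lambda_j>0$, $\Re\mu_j\ge0$. The quadruple $(\omega,Q,\boldsymbol\lambda,\boldsymbol\mu)$ is called the data of the functional equation; one $F$ may have several data. Let $I(\omega,Q,\boldsymbol\lambda,\boldsymbol\mu)$ be a complex-valued function defined on the data of the functional equations of the $F\in\mathcal S^\sharp$. It is an *invariant* if any two data of the functional equation of the same $F\in\mathcal S^\sharp$ give the same value of $I$. Let $I^*(R,\omega,Q,\boldsymbol\lambda,\boldsymbol\mu)$ be a complex-valued function of a rational function $R\not\equiv0$ over $\mathbb C$ and of arbitrary $\omega,Q,\boldsymbol\lambda,\boldsymbol\mu$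 subject to the conditions listed after (1), regarded as a function of the product $R(s)\gamma(s)$ (and of $\omega$). * $I^*$ is a *rational extension* of $I$ if $I^*(R,\omega,Q,\boldsymbol\lambda,\boldsymbol\mu)=I(\omega,Q,\boldsymbol\lambda,\boldsymbol\mu)$ for every non-zero constant $R$ and all data of functional equations of the $F\in\mathcal S^\sharp$. * $I^*$ is *stable under the multiplication formula* if $I^*(R,\omega,Q,\boldsymbol\lambda,\boldsymbol\mu)=I^*(R,\omega\overline c/c,Q',\boldsymbol\lambda',\boldsymbol\mu')$ whenever, for some $m\ge1$, one factor $\Gamma(\lambda s+\mu)$ of $\gamma$ is replaced, according to the Legendre–Gauss formula, by the $m$ factors $\Gamma\big(\tfrac{\lambda}{m}s+\tfrac{\mu+k}{m}\big)$, $0\le k<m$, with $Q'=Qm^{\lambda}$ and $c=m^{\mu-1/2}(2\pi)^{(1-m)/2}$, so that $\gamma=c\gamma'$ (the order of the factors in a product is immaterial). * $I^*$ is *stable under the factorial formula* if $I^*(R,\omega,Q,\boldsymbol\lambda,\boldsymbol\mu)=I^*(R',\omega,Q,\boldsymbol\lambda,\boldsymbol\mu')$ whenever one factor $\Gamma(\lambda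 s+\mu)$ of $\gamma$ is replaced either by $\Gamma(\lambda s+\mu-1)$, with $R'(s)=(\lambda s+\mu-1)R(s)$ (provided $\Re\mu\ge1$), or by $\Gamma(\lambda s+\mu+1)$, with $R'(s)=(\lambda s+\mu)^{-1}R(s)$ (again, the order of the factors is immaterial). **Theorem.** $I$ is an invariant if and only if it has a rational extension $I^*$ which is stable under the multiplication and factorial formulae. Moreover, such an $I^*$ is explicit. Put $d=2\sum_j\lambda_j$, $q=(2\pi)^{d}Q^2\prod_j\lambda_j^{2\lambda_j}$, $\omega^\circ=\omega\prod_j\lambda_j^{-2i\Im\mu_j}$ and, for $n\ge0$, with $B_n$ the Bernoulli polynomials, $$H(n)=2\sum_{j}\frac{B_n(\mu_j)}{\lambda_j^{n-1}},\qquad H^*(n;R\gamma)=H(n)+(-1)^n2n\Big(\sum_\beta\beta^{n-1}-\sum_\alpha\alpha^{n-1}\Big),$$ where $\alpha$ runs over the zeros and $\beta$ over the poles of $R$ with multiplicity, and $H^*(0;R\gamma)=H(0)=d$. If $I$ is an invariant, there is a function $\tilde I$ with $I(\omega,Q,\boldsymbol\lambda,\boldsymbol\mu)=\tilde I\big(\omega^\circ,q,(H(n))_{n\ge0}\big)$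 for all data of functional equations of the $F\in\mathcal S^\sharp$, and such that $$I^*(R,\omega,Q,\boldsymbol\lambda,\boldsymbol\mu)=\tilde I\big(\omega^\circ,q,(H^*(n;R\gamma))_{n\ge0}\big)$$ is a rational extension of $I$ that is stable under the multiplication and factorial formulae. -/

import Mathlib

open scoped ComplexConjugate

namespace ExtSelberg

noncomputable section

/-- Formal data `ω, Q, λ = (λ₁, …, λ_r), μ = (μ₁, …, μ_r)` of a Riemann type functional equation:
`|ω| = 1`, `Q > 0`, `λ_j > 0`, `Re μ_j ≥ 0`, and `r ≥ 0`. -/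
structure GammaData where
  ω : ℂ
  Q : ℝ
  r : ℕ
  lam : Fin r → ℝ
  mu : Fin r → ℂ
  norm_ω : ‖ω‖ = 1
  Q_pos : 0 < Q
  lam_pos : ∀ j, 0 < lam j
  mu_re_nonneg : ∀ j, 0 ≤ (mu j).re

/-- The pairs `(λ_j, μ_j)`, counted with multiplicity, without regard to their order; they say which
Gamma factors `Γ(λ_j s + μ_j)` occur in the product. -/
def GammaData.factors (D : GammaData) : Multiset (ℝ × ℂ) :=
  (Finset.univ : Finset (Fin D.r)).val.map fun j => (D.lam j, D.mu j)

/-- The `γ`-factor `γ(s) = Q^s ∏_j Γ(λ_j s + μ_j)` (meaningful away from `GammaData.IsPole`). -/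
def GammaData.gammaFactor (D : GammaData) (s : ℂ) : ℂ :=
  (D.Q : ℂ) ^ s * ∏ j, Complex.Gamma ((D.lam j : ℂ) * s + D.mu j)

/-- `s` is a pole of the `γ`-factor. -/
def GammaData.IsPole (D : GammaData) (s : ℂ) : Prop :=
  ∃ (j : Fin D.r) (k : ℕ), (D.lam j : ℂ) * s + D.mu j = -(k : ℂ)

/-- `f̄(s) = conj (f (conj s))`. -/
def bar (f : ℂ → ℂ) (s : ℂ) : ℂ := conj (f (conj s))

/-- The functional equation `γ(s) F(s) = ω γ̄(1 - s) F̄(1 - s)` with data `D`, as an identity of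
meromorphic functions: it is required at every point at which no pole can occur
(`F` may have a pole at `1` only, so `F̄(1 - s)` may have a pole at `0` only). -/
def FunctionalEquation (F : ℂ → ℂ) (D : GammaData) : Prop :=
  ∀ s : ℂ, s ≠ 0 → s ≠ 1 → ¬ D.IsPole s → ¬ D.IsPole (conj (1 - s)) →
    D.gammaFactor s * F s = D.ω * bar D.gammaFactor (1 - s) * bar F (1 - s)

/-- `F` belongs to the extended Selberg class: a Dirichlet series, absolutely convergent for
`Re s > 1` and not identically zero, such that `(s - 1)^m F(s)` continues to an entire function of
finite order for some `m ≥ 0`, and which satisfies a functional equation of the above type.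
The function `F` stands for the continuation; its value at the possible pole `1` plays no role. -/
structure IsExtendedSelberg (F : ℂ → ℂ) : Prop where
  dirichlet : ∃ a : ℕ → ℂ, ∀ s : ℂ, 1 < s.re → LSeriesHasSum a s (F s)
  ne_zero : ∃ s : ℂ, 1 < s.re ∧ F s ≠ 0
  continuation : ∃ (m : ℕ) (G : ℂ → ℂ), Differentiable ℂ G ∧
    (∃ ρ : ℝ, G =O[Bornology.cobounded ℂ] fun s => Real.exp (‖s‖ ^ ρ)) ∧
    ∀ s : ℂ, s ≠ 1 → (s - 1) ^ m * F s = G s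
  functionalEquation : ∃ D : GammaData, FunctionalEquation F D

/-- The data that occur in the functional equation of some member of the extended Selberg class. -/
def SelbergData : Type :=
  {D : GammaData // ∃ F : ℂ → ℂ, IsExtendedSelberg F ∧ FunctionalEquation F D}

/-- A function of the data is an invariant if its value depends only on `F`. -/
def IsInvariant (I : SelbergData → ℂ) : Prop :=
  ∀ F : ℂ → ℂ, IsExtendedSelberg F → ∀ D D' : SelbergData,
    FunctionalEquation F D.1 → FunctionalEquation F D'.1 → I D = I D'

/-- `Istar (R, ω, Q, λ, μ)` is a rational extension of `I`: they agree for nonzero constant `R`.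
Only rational functions `R ≠ 0` matter: values of `Istar` at `R = 0` are never used. -/
def IsRationalExtension (Istar : RatFunc ℂ → GammaData → ℂ) (I : SelbergData → ℂ) : Prop :=
  ∀ κ : ℂ, κ ≠ 0 → ∀ D : SelbergData, Istar (RatFunc.C κ) D.1 = I D

/-- One application of the multiplication formula
`Γ(z) = m^(z - 1/2) (2π)^((1 - m)/2) ∏_{k < m} Γ((z + k)/m)` at `z = l s + μ` to one of the factors
of the `γ`-factor `γ` of `D`; it gives `γ = c γ'`, where `γ'` is the `γ`-factor of `D'`.
The datum `ω` becomes `ω c̄ / c`. -/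
def MultiplicationStep (D D' : GammaData) : Prop :=
  ∃ (m : ℕ) (l : ℝ) (μ : ℂ) (S : Multiset (ℝ × ℂ)) (c : ℂ), 1 ≤ m ∧
    D.factors = (l, μ) ::ₘ S ∧
    D'.factors = (Multiset.range m).map (fun k : ℕ => (l / (m : ℝ), (μ + (k : ℂ)) / (m : ℂ))) + S ∧
    c = (m : ℂ) ^ (μ - 1 / 2) * (2 * (Real.pi : ℂ)) ^ ((1 - (m : ℂ)) / 2) ∧
    D'.Q = D.Q * (m : ℝ) ^ l ∧
    D'.ω = D.ω * conj c / c

/-- The factorial formula, expanding: in `R(s) γ(s)` one factor `Γ(l s + μ)` is replaced by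
`(l s + μ - 1) Γ(l s + μ - 1)`, which gives `R'(s) γ'(s)`. -/
def ExpandingStep (R : RatFunc ℂ) (D : GammaData) (R' : RatFunc ℂ) (D' : GammaData) : Prop :=
  ∃ (l : ℝ) (μ : ℂ) (S : Multiset (ℝ × ℂ)),
    D.factors = (l, μ) ::ₘ S ∧ D'.factors = (l, μ - 1) ::ₘ S ∧
    R' = (RatFunc.C (l : ℂ) * RatFunc.X + RatFunc.C (μ - 1)) * R ∧
    D'.Q = D.Q ∧ D'.ω = D.ω

/-- The factorial formula, contracting: in `R(s) γ(s)` one factor `Γ(l s + μ)` is replaced by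
`(l s + μ)⁻¹ Γ(l s + μ + 1)`, which gives `R'(s) γ'(s)`. -/
def ContractingStep (R : RatFunc ℂ) (D : GammaData) (R' : RatFunc ℂ) (D' : GammaData) : Prop :=
  ∃ (l : ℝ) (μ : ℂ) (S : Multiset (ℝ × ℂ)),
    D.factors = (l, μ) ::ₘ S ∧ D'.factors = (l, μ + 1) ::ₘ S ∧
    R' = (RatFunc.C (l : ℂ) * RatFunc.X + RatFunc.C μ)⁻¹ * R ∧
    D'.Q = D.Q ∧ D'.ω = D.ω

/-- Stability under the multiplication formula. -/
def StableMultiplication (Istar : RatFunc ℂ → GammaData → ℂ) : Prop :=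
  ∀ R : RatFunc ℂ, R ≠ 0 → ∀ D D' : GammaData, MultiplicationStep D D' → Istar R D = Istar R D'

/-- Stability under the factorial formula. -/
def StableFactorial (Istar : RatFunc ℂ → GammaData → ℂ) : Prop :=
  ∀ R R' : RatFunc ℂ, R ≠ 0 → R' ≠ 0 → ∀ D D' : GammaData,
    ExpandingStep R D R' D' ∨ ContractingStep R D R' D' → Istar R D = Istar R' D'

/-- The degree `d = 2 ∑_j λ_j`. -/
def GammaData.degree (D : GammaData) : ℝ := 2 * ∑ j, D.lam j

/-- The conductor `q = (2π)^d Q² ∏_j λ_j^(2 λ_j)`. -/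
def GammaData.conductor (D : GammaData) : ℝ :=
  (2 * Real.pi) ^ D.degree * D.Q ^ 2 * ∏ j, D.lam j ^ (2 * D.lam j)

/-- The root number `ω ∏_j λ_j^(-2 i Im μ_j)`. -/
def GammaData.rootNumber (D : GammaData) : ℂ :=
  D.ω * ∏ j, (D.lam j : ℂ) ^ (-2 * Complex.I * ((D.mu j).im : ℂ))

/-- `H(n) = 2 ∑_j B_n(μ_j) / λ_j^(n - 1)`, `n ≥ 0`, with the Bernoulli polynomials `B_n`. -/
def GammaData.hInvariant (D : GammaData) (n : ℕ) : ℂ :=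
  2 * ∑ j, Polynomial.aeval (D.mu j) (Polynomial.bernoulli n) / (D.lam j : ℂ) ^ ((n : ℤ) - 1)

/-- `H*(n) = H(n) + (-1)^n 2n (∑ β^(n-1) - ∑ α^(n-1))`, where `α` runs over the zeros and `β` over
the poles of `R`, with multiplicity. For `n = 0` the second term vanishes and `H*(0) = d`. -/
def hStar (R : RatFunc ℂ) (D : GammaData) (n : ℕ) : ℂ :=
  D.hInvariant n + (-1) ^ n * (2 * (n : ℂ)) *
    ((R.denom.roots.map fun β => β ^ (n - 1)).sum - (R.num.roots.map fun α => α ^ (n - 1)).sum)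

end

end ExtSelberg

/-!
The theorem rests on two facts: the poles of a `γ`-factor determine it up to applications of the
multiplication and factorial formulae, and these poles are in turn determined both by `F` and by the
numbers `H(n)`. Neither Stirling's formula nor a factorization theorem for entire functions is used.

*Poles determine the factors up to the formulae* (`exists_common_reduction`). Suppose `γ_D` and
`γ_{D'}` have the same poles with multiplicity. By the multiplication formula all Gamma factors
`Γ(l s + μ)` of both products can be split so that commensurable `l` become equal, and by the
factorial formula all `μ` can be moved into the strip `0 ≤ Re μ < 1`; this turns `γ_D` into `p γ_E`
and `γ_{D'}` into `p' γ_{E'}` with polynomials `p`, `p'`. Progressions `-(μ + k) / l` of poles with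
incommensurable `l` meet at most once, and those with the same `l` and different `μ` in the strip
are disjoint. So the multiplicity of a factor can be read off from its poles far to the left, where `p`
and `p'` do not vanish: `E` and `E'` have the same Gamma factors (`factors_eq_of_poleOrder_eq`).
Comparing the remaining poles, `p` and `p'` have the same zeros, so `p = κ p'`; here `κ > 0`, since
expanding a factor multiplies the leading coefficient by `l > 0`.

*`F` determines the poles* (`poleCount_eq_of_functionalEquation`). Dividing two functional equations
of `F` shows that `γ_D / γ_{D'}` equals, up to a constant, the dual quotient at `1 - s`, which has
neither zeros nor poles in `Re s < 1`. If now `D` and `D'` are data of the same `F`, then after the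
reduction the quotient `γ_D / γ_{D'}` is `C a ^ s`; the functional equations force `a = 1`, and, as
`κ` is real, equality of the `ω`. A stable extension is constant along the reductions, so it takes
the same value on `D` and `D'` (`isInvariant_of_stable`).

*`H` determines the poles* (`poleCount_eq_of_hInvariant_eq`). The generating series of the `H(n)` is
the sum of `2 X e^{μX/l} / (e^{X/l} - 1)` over the factors, and the pole counting function is
obtained from the same fraction when `e^{tX}` is read as translation by `t`. Both are governed by one
identity in the group algebra of `(ℂ, +)`, whose homomorphism to power series is injective. Hence the root
number, the conductor and the `H(n)` determine which `F` satisfy the functional equation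
(`functionalEquation_of_invariants_eq`), so an invariant is a function of them. The root number, the
conductor and `H*` are unchanged by both formulae, by Raabe's multiplication theorem and the
difference equation for Bernoulli polynomials; this gives the explicit extension.
-/

open scoped ComplexConjugate Topology

namespace ExtSelberg

/-! ### Invariance of the root number, the conductor and `H*` under the two formulae -/

open PowerSeries in
/-- The exponential series `e^{tX}`. -/
noncomputable def expSeries (t : ℂ) : PowerSeries ℂ := rescale t (exp ℂ)

theorem expSeries_mul (s t : ℂ) : expSeries s * expSeries t = expSeries (s + t) :=
  PowerSeries.exp_mul_exp_eq_exp_add s t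

theorem expSeries_zero : expSeries 0 = 1 := by
  simp [expSeries]

theorem expSeries_pow (t : ℂ) (k : ℕ) : expSeries t ^ k = expSeries (k * t) := by
  induction k with
  | zero => simp [expSeries_zero]
  | succ k ih => rw [pow_succ, ih, expSeries_mul]; congr 1; push_cast; ring

theorem coeff_expSeries (t : ℂ) (n : ℕ) :
    PowerSeries.coeff n (expSeries t) = t ^ n / (n.factorial : ℂ) := by
  simp [expSeries, PowerSeries.coeff_rescale, PowerSeries.coeff_exp, div_eq_mul_inv]

theorem expSeries_sub_one_ne_zero {t : ℂ} (ht : t ≠ 0) : expSeries t - 1 ≠ 0 := by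
  intro h
  have := congrArg (PowerSeries.coeff 1) h
  simp [coeff_expSeries, PowerSeries.coeff_one] at this
  exact ht this

/-- The contribution of the Gamma factor `Γ(l s + μ)` to `H(n)`. -/
noncomputable def hTerm (n : ℕ) (p : ℝ × ℂ) : ℂ :=
  2 * (Polynomial.aeval p.2 (Polynomial.bernoulli n) / (p.1 : ℂ) ^ ((n : ℤ) - 1))

/-- The exponential generating series of the contributions of `Γ(l s + μ)` to the `H(n)`. -/
noncomputable def hSeries (p : ℝ × ℂ) : PowerSeries ℂ :=
  PowerSeries.mk fun n => hTerm n p / (n.factorial : ℂ)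

/-- `Σ_n B_n(μ) l^{1-n} X^n / n! = X e^{μX/l} / (e^{X/l} - 1)`, cleared of denominators. -/
theorem hSeries_mul (p : ℝ × ℂ) (hp : p.1 ≠ 0) :
    hSeries p * (expSeries (1 / (p.1 : ℂ)) - 1) = 2 * PowerSeries.X * expSeries (p.2 / p.1) := by
  have hl : (p.1 : ℂ) ≠ 0 := by exact_mod_cast hp
  have h := congrArg (PowerSeries.rescale (1 / (p.1 : ℂ)))
    (Polynomial.bernoulli_generating_function p.2)
  rw [map_mul, map_sub, map_mul, map_one, PowerSeries.rescale_rescale,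
    PowerSeries.rescale_X] at h
  have h1 : hSeries p = PowerSeries.C (2 * (p.1 : ℂ)) * PowerSeries.rescale (1 / (p.1 : ℂ))
      (PowerSeries.mk fun n =>
        Polynomial.aeval p.2 ((1 / n.factorial : ℚ) • Polynomial.bernoulli n)) := by
    ext n
    rw [PowerSeries.coeff_C_mul, PowerSeries.coeff_rescale]
    simp only [hSeries, hTerm, PowerSeries.coeff_mk, Algebra.smul_def, zpow_sub₀ hl]
    simp
    field_simp
  have h2 : (PowerSeries.C (2 * (p.1 : ℂ))) * (PowerSeries.C (1 / (p.1 : ℂ)) * PowerSeries.X)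
      = 2 * PowerSeries.X := by
    rw [← mul_assoc, ← map_mul]
    congr 1
    rw [mul_assoc, mul_one_div_cancel hl, mul_one]
    exact map_ofNat _ 2
  rw [h1, mul_assoc]
  unfold expSeries
  rw [h, ← mul_assoc, h2]
  congr 3
  ring

/-- Raabe's multiplication theorem for Bernoulli polynomials, in the form of generating series. -/
theorem hSeries_multiplication (l : ℝ) (μ : ℂ) (m : ℕ) (hl : l ≠ 0) (hm : 1 ≤ m) :
    ∑ k ∈ Finset.range m, hSeries (l / (m : ℝ), (μ + (k : ℂ)) / (m : ℂ)) = hSeries (l, μ) := by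
  have hm0 : (m : ℝ) ≠ 0 := by positivity
  have hm1 : (m : ℂ) ≠ 0 := by exact_mod_cast hm0
  have hl1 : (l : ℂ) ≠ 0 := by exact_mod_cast hl
  have e1 : ∀ k ∈ Finset.range m, hSeries (l / (m : ℝ), (μ + (k : ℂ)) / (m : ℂ)) *
      (expSeries (m / l) - 1) =
      2 * PowerSeries.X * expSeries (μ / l) * expSeries (1 / l) ^ k := by
    intro k _
    have := hSeries_mul (l / (m : ℝ), (μ + (k : ℂ)) / (m : ℂ)) (div_ne_zero hl hm0)
    have a1 : (1 / ((l / (m : ℝ) : ℝ) : ℂ)) = m / l := by push_cast; field_simp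
    have a2 : (μ + (k : ℂ)) / (m : ℂ) / ((l / (m : ℝ) : ℝ) : ℂ) = μ / l + k * (1 / l) := by
      push_cast; field_simp
    simp only [a1, a2] at this
    rw [this, expSeries_pow, mul_assoc, mul_assoc, mul_assoc, expSeries_mul]
  have h1 := hSeries_mul (l, μ) hl
  simp only at h1
  have n1 := expSeries_sub_one_ne_zero (div_ne_zero hm1 hl1)
  have n2 := expSeries_sub_one_ne_zero (div_ne_zero one_ne_zero hl1)
  refine mul_right_cancel₀ n2 (mul_right_cancel₀ n1 ?_)
  rw [h1, mul_assoc, mul_comm (_ - _) (_ - _), ← mul_assoc, Finset.sum_mul, Finset.sum_congr rfl e1,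
    ← Finset.mul_sum, mul_assoc, geom_sum_mul, expSeries_pow]
  congr 3
  ring

theorem hTerm_multiplication (n : ℕ) (l : ℝ) (μ : ℂ) (m : ℕ) (hl : l ≠ 0) (hm : 1 ≤ m) :
    ∑ k ∈ Finset.range m, hTerm n (l / (m : ℝ), (μ + (k : ℂ)) / (m : ℂ)) = hTerm n (l, μ) := by
  have h := congrArg (PowerSeries.coeff n) (hSeries_multiplication l μ m hl hm)
  simp only [map_sum, hSeries, PowerSeries.coeff_mk, ← Finset.sum_div] at h
  exact (div_left_inj' (by exact_mod_cast n.factorial_ne_zero)).1 h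

/-- `B_n(μ + 1) = B_n(μ) + n μ^{n-1}`, in terms of the zero `-μ / l` of `l s + μ`. -/
theorem hTerm_add_one (n : ℕ) (l : ℝ) (μ : ℂ) (hl : l ≠ 0) :
    hTerm n (l, μ + 1) = hTerm n (l, μ) - (-1) ^ n * (2 * (n : ℂ)) * (-(μ / l)) ^ (n - 1) := by
  have hl1 : (l : ℂ) ≠ 0 := by exact_mod_cast hl
  have h := congrArg (Polynomial.aeval μ) (Polynomial.bernoulli_comp_one_add_X n)
  rw [Polynomial.aeval_comp] at h
  simp only [map_add, map_one, Polynomial.aeval_X] at h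
  simp only [hTerm]
  rw [add_comm μ 1, h]
  rcases n with _ | n
  · simp
  · simp [pow_succ, neg_pow (μ / l), div_pow]
    have : ((-1 : ℂ) ^ n) * (-1) ^ n = 1 := by rw [← mul_pow]; simp
    linear_combination (-2 * (n + 1) * (μ ^ n / (l : ℂ) ^ n)) * this

/-- The sum of `φ` over the poles of `R` minus the sum of `φ` over its zeros. -/
noncomputable def divisorSum (φ : ℂ → ℂ) (R : RatFunc ℂ) : ℂ :=
  (R.denom.roots.map φ).sum - (R.num.roots.map φ).sum

theorem divisorSum_mul (φ : ℂ → ℂ) {R S : RatFunc ℂ} (hR : R ≠ 0) (hS : S ≠ 0) :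
    divisorSum φ (R * S) = divisorSum φ R + divisorSum φ S := by
  have h := congrArg Polynomial.roots (RatFunc.num_denom_mul R S)
  have h1 := RatFunc.num_ne_zero hR
  have h2 := RatFunc.num_ne_zero hS
  have h3 := RatFunc.num_ne_zero (mul_ne_zero hR hS)
  have d1 := RatFunc.denom_ne_zero R
  have d2 := RatFunc.denom_ne_zero S
  have d3 := RatFunc.denom_ne_zero (R * S)
  rw [Polynomial.roots_mul (mul_ne_zero h3 (mul_ne_zero d1 d2)),
    Polynomial.roots_mul (mul_ne_zero d1 d2),
    Polynomial.roots_mul (mul_ne_zero (mul_ne_zero h1 h2) d3),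
    Polynomial.roots_mul (mul_ne_zero h1 h2)] at h
  have h' := congrArg (fun s => (s.map φ).sum) h
  simp only [Multiset.map_add, Multiset.sum_add] at h'
  unfold divisorSum
  linear_combination -h'

theorem divisorSum_C (φ : ℂ → ℂ) (κ : ℂ) : divisorSum φ (RatFunc.C κ) = 0 := by
  simp [divisorSum]

theorem linear_eq_algebraMap (a b : ℂ) : RatFunc.C a * RatFunc.X + RatFunc.C b =
    algebraMap (Polynomial ℂ) (RatFunc ℂ) (Polynomial.C a * Polynomial.X + Polynomial.C b) := by
  simp

theorem linear_ne_zero {a b : ℂ} (ha : a ≠ 0) :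
    RatFunc.C a * RatFunc.X + RatFunc.C b ≠ 0 := by
  rw [linear_eq_algebraMap, ne_eq, map_eq_zero_iff _ (RatFunc.algebraMap_injective ℂ)]
  intro h
  have := congrArg (Polynomial.coeff · 1) h
  simp [Polynomial.coeff_C] at this
  exact ha this

theorem divisorSum_linear (φ : ℂ → ℂ) {a b : ℂ} (ha : a ≠ 0) :
    divisorSum φ (RatFunc.C a * RatFunc.X + RatFunc.C b) = -φ (-(b / a)) := by
  rw [linear_eq_algebraMap]
  simp only [divisorSum, RatFunc.num_algebraMap, RatFunc.denom_algebraMap]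
  rw [Polynomial.roots_C_mul_X_add_C _ ha]
  simp [div_eq_inv_mul]

theorem GammaData.map_factors {α : Type*} (D : GammaData) (f : ℝ × ℂ → α) :
    D.factors.map f = (Finset.univ : Finset (Fin D.r)).val.map fun j => f (D.lam j, D.mu j) := by
  simp [GammaData.factors, Function.comp_def]

theorem GammaData.lam_pos_of_mem {D : GammaData} {p : ℝ × ℂ} (h : p ∈ D.factors) : 0 < p.1 := by
  simp only [GammaData.factors, Multiset.mem_map] at h
  obtain ⟨j, _, rfl⟩ := h
  exact D.lam_pos j

theorem GammaData.mu_re_nonneg_of_mem {D : GammaData} {p : ℝ × ℂ} (h : p ∈ D.factors) :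
    0 ≤ p.2.re := by
  simp only [GammaData.factors, Multiset.mem_map] at h
  obtain ⟨j, _, rfl⟩ := h
  exact D.mu_re_nonneg j

theorem GammaData.hInvariant_eq (D : GammaData) (n : ℕ) :
    D.hInvariant n = (D.factors.map (hTerm n)).sum := by
  rw [D.map_factors]
  simp only [GammaData.hInvariant, hTerm, Finset.mul_sum]
  rfl

theorem GammaData.rootNumber_eq (D : GammaData) :
    D.rootNumber =
      D.ω * (D.factors.map fun p => (p.1 : ℂ) ^ (-2 * Complex.I * (p.2.im : ℂ))).prod := by
  rw [D.map_factors]; rfl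

theorem GammaData.degree_eq (D : GammaData) : D.degree = 2 * (D.factors.map Prod.fst).sum := by
  rw [D.map_factors]; rfl

theorem GammaData.conductor_eq (D : GammaData) :
    D.conductor = (2 * Real.pi) ^ (2 * (D.factors.map Prod.fst).sum) * D.Q ^ 2 *
      (D.factors.map fun p => p.1 ^ (2 * p.1)).prod := by
  rw [← D.degree_eq, D.map_factors]; rfl

theorem hStar_eq (R : RatFunc ℂ) (D : GammaData) (n : ℕ) :
    hStar R D n = (D.factors.map (hTerm n)).sum +
      (-1) ^ n * (2 * (n : ℂ)) * divisorSum (fun x => x ^ (n - 1)) R := by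
  rw [hStar, D.hInvariant_eq]; rfl

theorem hStar_C (κ : ℂ) (D : GammaData) : hStar (RatFunc.C κ) D = D.hInvariant := by
  ext n
  rw [hStar_eq, divisorSum_C, D.hInvariant_eq, mul_zero, add_zero]

theorem MultiplicationStep.hStar_eq {D D' : GammaData} (h : MultiplicationStep D D')
    (R : RatFunc ℂ) : hStar R D = hStar R D' := by
  obtain ⟨m, l, μ, S, c, hm, hD, hD', -⟩ := h
  ext n
  have hl : l ≠ 0 := (D.lam_pos_of_mem (p := (l, μ)) (by simp [hD])).ne'
  rw [ExtSelberg.hStar_eq, ExtSelberg.hStar_eq, hD, hD', Multiset.map_add,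
    Multiset.sum_add, Multiset.map_cons, Multiset.sum_cons, ← hTerm_multiplication n l μ m hl hm]
  simp only [Multiset.map_map, Function.comp_def]
  rfl

theorem MultiplicationStep.conductor_eq {D D' : GammaData} (h : MultiplicationStep D D') :
    D.conductor = D'.conductor := by
  obtain ⟨m, l, μ, S, c, hm, hD, hD', -, hQ, -⟩ := h
  have hm0 : (0 : ℝ) < m := by positivity
  have hl : 0 < l := D.lam_pos_of_mem (p := (l, μ)) (by simp [hD])
  rw [GammaData.conductor_eq, GammaData.conductor_eq, hD, hD', hQ]
  simp only [Multiset.map_add, Multiset.map_cons, Multiset.map_map, Function.comp_def,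
    Multiset.sum_add, Multiset.prod_add, Multiset.sum_cons, Multiset.prod_cons, Multiset.map_const',
    Multiset.sum_replicate, Multiset.prod_replicate, Multiset.card_range, nsmul_eq_mul,
    mul_div_cancel₀ _ hm0.ne']
  have e : ((l / m) ^ (2 * (l / m))) ^ m * ((m : ℝ) ^ l) ^ 2 = l ^ (2 * l) := by
    rw [← Real.rpow_natCast, ← Real.rpow_mul (by positivity), ← Real.rpow_natCast,
      ← Real.rpow_mul (by positivity), Real.div_rpow hl.le hm0.le]
    have : 2 * (l / m) * m = 2 * l := by field_simp
    rw [this, mul_comm l, Nat.cast_ofNat]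
    have := (Real.rpow_pos_of_pos hm0 (2 * l)).ne'
    field_simp
  rw [← e]
  ring

theorem conj_natCast_cpow (m : ℕ) (z : ℂ) : conj ((m : ℂ) ^ z) = (m : ℂ) ^ conj z := by
  rw [Complex.cpow_conj _ _ (by rw [Complex.natCast_arg]; exact Real.pi_pos.ne),
    Complex.conj_natCast]

theorem conj_div_of_pos_mul {t : ℝ} (ht : 0 < t) (z : ℂ) :
    conj ((t : ℂ) * z) / ((t : ℂ) * z) = conj z / z := by
  rw [map_mul, Complex.conj_ofReal, mul_div_mul_left _ _ (by exact_mod_cast ht.ne')]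

/-- The constant of the Legendre–Gauss formula is a positive multiple of `m ^ μ`; only its argument
enters the multiplication formula for data. -/
theorem gauss_constant_eq (m : ℕ) (μ : ℂ) (hm : 1 ≤ m) : ∃ t : ℝ, 0 < t ∧
    (m : ℂ) ^ (μ - 1 / 2) * (2 * (Real.pi : ℂ)) ^ ((1 - (m : ℂ)) / 2) = t * (m : ℂ) ^ μ := by
  have hm0 : (0 : ℝ) < m := by positivity
  have hm1 : (m : ℂ) ≠ 0 := by exact_mod_cast hm0.ne'
  refine ⟨(m : ℝ) ^ (-(1 / 2) : ℝ) * (2 * Real.pi) ^ ((1 - (m : ℝ)) / 2), by positivity, ?_⟩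
  rw [sub_eq_add_neg, Complex.cpow_add _ _ hm1]
  push_cast [Complex.ofReal_cpow hm0.le, Complex.ofReal_cpow Real.two_pi_pos.le]
  ring

theorem MultiplicationStep.rootNumber_eq {D D' : GammaData} (h : MultiplicationStep D D') :
    D.rootNumber = D'.rootNumber := by
  obtain ⟨m, l, μ, S, c, hm, hD, hD', hc, -, hω⟩ := h
  have hm0 : (0 : ℝ) < m := by positivity
  have hm1 : (m : ℂ) ≠ 0 := by exact_mod_cast hm0.ne'
  have hl : 0 < l := D.lam_pos_of_mem (p := (l, μ)) (by simp [hD])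
  rw [GammaData.rootNumber_eq, GammaData.rootNumber_eq, hD, hD', hω]
  simp only [Multiset.map_add, Multiset.map_cons, Multiset.map_map, Function.comp_def,
    Multiset.prod_add, Multiset.prod_cons]
  have e1 : ∀ k : ℕ, ((μ + (k : ℂ)) / (m : ℂ)).im = μ.im / m := by
    intro k
    have : (μ + (k : ℂ)) / (m : ℂ) = (μ + (k : ℂ)) / ((m : ℝ) : ℂ) := by push_cast; rfl
    rw [this, Complex.div_ofReal_im]; simp
  simp only [e1, Multiset.map_const', Multiset.prod_replicate, Multiset.card_range]
  have hcc : conj c / c = (m : ℂ) ^ (-2 * Complex.I * (μ.im : ℂ)) := by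
    obtain ⟨t, ht, htc⟩ := gauss_constant_eq m μ hm
    rw [hc, htc, conj_div_of_pos_mul ht, conj_natCast_cpow, ← Complex.cpow_sub _ _ hm1]
    congr 1
    apply Complex.ext <;> simp
    ring
  have e2 : (((l / m : ℝ) : ℂ) ^ (-2 * Complex.I * ((μ.im / m : ℝ) : ℂ))) ^ m *
      (m : ℂ) ^ (-2 * Complex.I * (μ.im : ℂ)) = (l : ℂ) ^ (-2 * Complex.I * (μ.im : ℂ)) := by
    rw [← Complex.cpow_nat_mul]
    have h5 : (m : ℂ) * (-2 * Complex.I * ((μ.im / m : ℝ) : ℂ)) = -2 * Complex.I * (μ.im : ℂ) := by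
      push_cast; field_simp
    rw [h5]
    have := Complex.mul_cpow_ofReal_nonneg (a := l / m) (b := m) (by positivity) hm0.le
      (-2 * Complex.I * (μ.im : ℂ))
    rw [Complex.ofReal_natCast] at this
    rw [← this, ← Complex.ofReal_natCast, ← Complex.ofReal_mul, div_mul_cancel₀ _ hm0.ne']
  rw [mul_div_assoc, hcc, ← e2]
  ring

theorem ExpandingStep.hStar_eq {R R' : RatFunc ℂ} {D D' : GammaData} (hR : R ≠ 0)
    (h : ExpandingStep R D R' D') : hStar R D = hStar R' D' := by
  obtain ⟨l, μ, S, hD, hD', rfl, -⟩ := h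
  have hl : l ≠ 0 := (D.lam_pos_of_mem (p := (l, μ)) (by simp [hD])).ne'
  have hl1 : (l : ℂ) ≠ 0 := by exact_mod_cast hl
  ext n
  rw [ExtSelberg.hStar_eq, ExtSelberg.hStar_eq, divisorSum_mul _ ?_ hR,
    divisorSum_linear _ hl1, hD, hD']
  · have := hTerm_add_one n l (μ - 1) hl
    rw [sub_add_cancel] at this
    simp only [Multiset.map_cons, Multiset.sum_cons, this]
    ring
  · exact linear_ne_zero hl1

/-- Contracting a factor is the inverse of expanding it. -/
theorem ContractingStep.expandingStep {R R' : RatFunc ℂ} {D D' : GammaData}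
    (h : ContractingStep R D R' D') : ExpandingStep R' D' R D := by
  obtain ⟨l, μ, S, hD, hD', rfl, hQ, hω⟩ := h
  have hl : l ≠ 0 := (D.lam_pos_of_mem (p := (l, μ)) (by simp [hD])).ne'
  refine ⟨l, μ + 1, S, hD', by simpa using hD, ?_, hQ.symm, hω.symm⟩
  rw [add_sub_cancel_right, ← mul_assoc, mul_inv_cancel₀, one_mul]
  exact linear_ne_zero (by exact_mod_cast hl)

theorem ExpandingStep.conductor_eq {R R' : RatFunc ℂ} {D D' : GammaData}
    (h : ExpandingStep R D R' D') : D.conductor = D'.conductor := by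
  obtain ⟨l, μ, S, hD, hD', -, hQ, -⟩ := h
  rw [GammaData.conductor_eq, GammaData.conductor_eq, hD, hD', hQ]
  simp

theorem ExpandingStep.rootNumber_eq {R R' : RatFunc ℂ} {D D' : GammaData}
    (h : ExpandingStep R D R' D') : D.rootNumber = D'.rootNumber := by
  obtain ⟨l, μ, S, hD, hD', -, -, hω⟩ := h
  rw [GammaData.rootNumber_eq, GammaData.rootNumber_eq, hD, hD', hω]
  simp

/-! ### Gauss multiplication formula up to a constant -/

/-- `m ^ x ∏_{k < m} Γ((x + k) / m)`, a constant multiple of `Γ(x)`. -/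
noncomputable def gaussProduct (m : ℕ) (x : ℝ) : ℝ :=
  (m : ℝ) ^ x * ∏ k ∈ Finset.range m, Real.Gamma ((x + k) / m)

theorem gaussProduct_pos {m : ℕ} (hm : 1 ≤ m) {x : ℝ} (hx : 0 < x) : 0 < gaussProduct m x := by
  have hm0 : (0 : ℝ) < m := by positivity
  exact mul_pos (Real.rpow_pos_of_pos hm0 _)
    (Finset.prod_pos fun k _ => Real.Gamma_pos_of_pos (by positivity))

theorem gaussProduct_add_one {m : ℕ} (hm : 1 ≤ m) {x : ℝ} (hx : 0 < x) :
    gaussProduct m (x + 1) = x * gaussProduct m x := by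
  obtain ⟨n, rfl⟩ : ∃ n, m = n + 1 := ⟨m - 1, by omega⟩
  have hm0 : ((n + 1 : ℕ) : ℝ) ≠ 0 := by positivity
  unfold gaussProduct
  rw [Finset.prod_range_succ, Finset.prod_range_succ' _ n, Real.rpow_add_one hm0]
  have e1 : (x + 1 + (n : ℝ)) / ((n + 1 : ℕ) : ℝ) = x / ((n + 1 : ℕ) : ℝ) + 1 := by
    push_cast; field_simp; ring
  have e2 : ∀ k : ℕ, x + ((k + 1 : ℕ) : ℝ) = x + 1 + k := by intro k; push_cast; ring
  rw [e1, Real.Gamma_add_one (by positivity)]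
  simp only [e2, Nat.cast_zero, add_zero]
  field_simp

theorem convexOn_log_gaussProduct {m : ℕ} (hm : 1 ≤ m) :
    ConvexOn ℝ (Set.Ioi 0) fun x => Real.log (gaussProduct m x) := by
  have hm0 : (0 : ℝ) < m := by positivity
  have h : Set.EqOn (fun x => x * Real.log m + ∑ k ∈ Finset.range m,
      (Real.log ∘ Real.Gamma) ((1 / (m : ℝ)) * x + k / m))
      (fun x => Real.log (gaussProduct m x)) (Set.Ioi 0) := by
    intro x hx
    have hx : (0 : ℝ) < x := hx
    simp only [gaussProduct]
    rw [Real.log_mul (Real.rpow_pos_of_pos hm0 _).ne'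
      (Finset.prod_pos fun k _ => Real.Gamma_pos_of_pos (by positivity)).ne', Real.log_rpow hm0,
      Real.log_prod (fun k _ => (Real.Gamma_pos_of_pos (by positivity)).ne')]
    congr 1
    refine Finset.sum_congr rfl fun k _ => ?_
    simp only [Function.comp]
    congr 2; ring
  have hI : Convex ℝ (Set.Ioi (0 : ℝ)) := convex_Ioi 0
  have a1 : ConvexOn ℝ (Set.Ioi 0) (fun x : ℝ => x * Real.log m) := by
    refine ⟨hI, fun x _ y _ a b _ _ _ => le_of_eq ?_⟩
    simp only [smul_eq_mul]; ring
  have a2 : ConvexOn ℝ (Set.Ioi 0) (fun x : ℝ => ∑ k ∈ Finset.range m,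
      (Real.log ∘ Real.Gamma) ((1 / (m : ℝ)) * x + k / m)) := by
    refine ⟨hI, fun x hx y hy a b ha hb hab => ?_⟩
    have hx : (0 : ℝ) < x := hx
    have hy : (0 : ℝ) < y := hy
    simp only [smul_eq_mul, Finset.mul_sum, ← Finset.sum_add_distrib]
    refine Finset.sum_le_sum fun k _ => ?_
    have := Real.convexOn_log_Gamma.2 (x := 1 / (m : ℝ) * x + k / m) (y := 1 / (m : ℝ) * y + k / m)
      (Set.mem_Ioi.2 (by positivity)) (Set.mem_Ioi.2 (by positivity)) ha hb hab
    simp only [smul_eq_mul] at this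
    convert this using 2
    linear_combination (-(k / m : ℝ)) * hab
  exact (a1.add a2).congr h

theorem gaussProduct_eq {m : ℕ} (hm : 1 ≤ m) {x : ℝ} (hx : 0 < x) :
    gaussProduct m x = gaussProduct m 1 * Real.Gamma x := by
  have h1 := gaussProduct_pos hm one_pos
  have key := Real.eq_Gamma_of_log_convex (f := fun x => gaussProduct m x / gaussProduct m 1) ?_
    (fun {y} hy => by simp only [gaussProduct_add_one hm hy, mul_div_assoc])
    (fun {y} hy => div_pos (gaussProduct_pos hm hy) h1) (div_self h1.ne') hx
  · simp only at key
    rw [← key, mul_div_cancel₀ _ h1.ne']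
  · refine ConvexOn.congr
      ((convexOn_log_gaussProduct hm).add_const (-Real.log (gaussProduct m 1))) ?_
    intro x hx
    simp only [Function.comp]
    rw [Real.log_div (gaussProduct_pos hm hx).ne' h1.ne', sub_eq_add_neg]
    rfl

/-- The Gauss multiplication formula up to the value of the constant, of which only positivity
is asserted. -/
theorem exists_gauss_multiplication {m : ℕ} (hm : 1 ≤ m) : ∃ C : ℝ, 0 < C ∧ ∀ z : ℂ, 0 < z.re →
    Complex.Gamma z = C * ((m : ℂ) ^ z * ∏ k ∈ Finset.range m, Complex.Gamma ((z + k) / m)) := by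
  have hm0 : (0 : ℝ) < m := by positivity
  have hm1 : (m : ℂ) ≠ 0 := by exact_mod_cast hm0.ne'
  have h1 := gaussProduct_pos hm one_pos
  refine ⟨(gaussProduct m 1)⁻¹, inv_pos.2 h1, ?_⟩
  set U : Set ℂ := {z | 0 < z.re}
  have hU : IsOpen U := isOpen_lt continuous_const Complex.continuous_re
  have hdG : ∀ z : ℂ, 0 < z.re → DifferentiableAt ℂ Complex.Gamma z := by
    intro z hz
    refine Complex.differentiableAt_Gamma _ fun k hk => ?_
    rw [hk] at hz
    simp at hz
    linarith [(Nat.cast_nonneg k : (0 : ℝ) ≤ k)]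
  have hre : ∀ z : ℂ, 0 < z.re → ∀ k : ℕ, 0 < ((z + k) / m).re := by
    intro z hz k
    rw [← Complex.ofReal_natCast m, Complex.div_ofReal_re]
    simp only [Complex.add_re, Complex.natCast_re]
    positivity
  have hf : AnalyticOnNhd ℂ Complex.Gamma U :=
    DifferentiableOn.analyticOnNhd (fun z hz => (hdG z hz).differentiableWithinAt) hU
  have hg : AnalyticOnNhd ℂ (fun z => ((gaussProduct m 1)⁻¹ : ℝ) *
      ((m : ℂ) ^ z * ∏ k ∈ Finset.range m, Complex.Gamma ((z + k) / m))) U := by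
    refine DifferentiableOn.analyticOnNhd
      (fun z hz => DifferentiableAt.differentiableWithinAt ?_) hU
    refine DifferentiableAt.const_mul (DifferentiableAt.mul ?_ ?_) _
    · exact differentiableAt_id.const_cpow (Or.inl hm1)
    · refine DifferentiableAt.fun_finsetProd fun k _ => ?_
      exact DifferentiableAt.comp z (hdG _ (hre z hz k)) (by fun_prop)
  have hpre : IsPreconnected U := (convex_halfSpace_re_gt 0).isPreconnected
  refine hf.eqOn_of_preconnected_of_frequently_eq hg hpre (show (1 : ℂ) ∈ U by simp [U]) ?_
  have hreal : ∀ x : ℝ, 0 < x → Complex.Gamma (x : ℂ) = ((gaussProduct m 1)⁻¹ : ℝ) *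
      ((m : ℂ) ^ (x : ℂ) * ∏ k ∈ Finset.range m, Complex.Gamma (((x : ℂ) + k) / m)) := by
    intro x hx
    have e := gaussProduct_eq hm hx
    have : Real.Gamma x = (gaussProduct m 1)⁻¹ * gaussProduct m x := by
      rw [e, inv_mul_cancel_left₀ h1.ne']
    have hcast : ((gaussProduct m x : ℝ) : ℂ) =
        (m : ℂ) ^ (x : ℂ) * ∏ k ∈ Finset.range m, Complex.Gamma (((x : ℂ) + k) / m) := by
      rw [gaussProduct, Complex.ofReal_mul, Complex.ofReal_cpow hm0.le, Complex.ofReal_prod]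
      simp [← Complex.Gamma_ofReal]
    rw [Complex.Gamma_ofReal, this, Complex.ofReal_mul, hcast]
  have ht : Filter.Tendsto (fun x : ℝ => (x : ℂ)) (nhdsWithin 1 {1}ᶜ) (nhdsWithin 1 {1}ᶜ) := by
    refine tendsto_nhdsWithin_of_tendsto_nhds_of_eventually_within _ ?_ ?_
    · exact (Complex.continuous_ofReal.tendsto' 1 1 (by simp)).mono_left nhdsWithin_le_nhds
    · filter_upwards [self_mem_nhdsWithin] with x hx
      simpa using hx
  refine ht.frequently (Filter.Eventually.frequently ?_)
  filter_upwards [mem_nhdsWithin_of_mem_nhds (lt_mem_nhds (zero_lt_one' ℝ))] with x hx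
  exact hreal x hx

/-! ### Reduction to a common form of Gamma factors -/

/-- `Reduces D p E`: the product `1 · γ_D` can be rewritten as `p · γ_E` (up to a constant), where
`p` is a polynomial, by applications of the multiplication formula and expansions of factors. -/
inductive Reduces (D : GammaData) : Polynomial ℂ → GammaData → Prop
  | refl : Reduces D 1 D
  | mult {p : Polynomial ℂ} {E E' : GammaData} :
      Reduces D p E → MultiplicationStep E E' → Reduces D p E'
  | expand {p : Polynomial ℂ} {E E' : GammaData} (l : ℝ) (μ : ℂ) (S : Multiset (ℝ × ℂ)) :
      Reduces D p E → E.factors = (l, μ) ::ₘ S → E'.factors = (l, μ - 1) ::ₘ S →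
      E'.Q = E.Q → E'.ω = E.ω →
      Reduces D ((Polynomial.C (l : ℂ) * Polynomial.X + Polynomial.C (μ - 1)) * p) E'

/-- The leading coefficient stays positive: this is what identifies root numbers once the
polynomials agree up to a constant. -/
theorem Reduces.leadingCoeff_pos {D E : GammaData} {p : Polynomial ℂ} (h : Reduces D p E) :
    ∃ t : ℝ, 0 < t ∧ p.leadingCoeff = t := by
  induction h with
  | refl => exact ⟨1, one_pos, by simp⟩
  | mult _ _ ih => exact ih
  | @expand p E E' l μ S _ hE _ _ _ ih =>
    obtain ⟨t, ht, e⟩ := ih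
    have hl : 0 < l := E.lam_pos_of_mem (p := (l, μ)) (by simp [hE])
    refine ⟨l * t, mul_pos hl ht, ?_⟩
    rw [Polynomial.leadingCoeff_mul, Polynomial.leadingCoeff_linear (by exact_mod_cast hl.ne'), e]
    push_cast; rfl

theorem Reduces.ne_zero {D E : GammaData} {p : Polynomial ℂ} (h : Reduces D p E) : p ≠ 0 := by
  obtain ⟨t, ht, e⟩ := h.leadingCoeff_pos
  rw [← Polynomial.leadingCoeff_ne_zero, e]
  exact_mod_cast ht.ne'

/-- An expansion of a factor, for the rational function `C κ * p`. -/
theorem expandingStep_of_factors {E E' : GammaData} {l : ℝ} {μ : ℂ} {S : Multiset (ℝ × ℂ)}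
    (h1 : E.factors = (l, μ) ::ₘ S) (h2 : E'.factors = (l, μ - 1) ::ₘ S) (h3 : E'.Q = E.Q)
    (h4 : E'.ω = E.ω) (κ : ℂ) (p : Polynomial ℂ) :
    ExpandingStep (RatFunc.C κ * algebraMap _ _ p) E (RatFunc.C κ * algebraMap _ _
      ((Polynomial.C (l : ℂ) * Polynomial.X + Polynomial.C (μ - 1)) * p)) E' := by
  refine ⟨l, μ, S, h1, h2, ?_, h3, h4⟩
  rw [map_mul (algebraMap _ _), ← linear_eq_algebraMap]
  ring

theorem Reduces.rootNumber_eq {D E : GammaData} {p : Polynomial ℂ} (h : Reduces D p E) :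
    D.rootNumber = E.rootNumber := by
  induction h with
  | refl => rfl
  | mult _ hm ih => exact ih.trans hm.rootNumber_eq
  | @expand p E E' l μ S _ h1 h2 h3 h4 ih =>
    exact ih.trans (expandingStep_of_factors h1 h2 h3 h4 1 p).rootNumber_eq

theorem Reduces.conductor_eq {D E : GammaData} {p : Polynomial ℂ} (h : Reduces D p E) :
    D.conductor = E.conductor := by
  induction h with
  | refl => rfl
  | mult _ hm ih => exact ih.trans hm.conductor_eq
  | @expand p E E' l μ S _ h1 h2 h3 h4 ih =>
    exact ih.trans (expandingStep_of_factors h1 h2 h3 h4 1 p).conductor_eq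

theorem C_mul_algebraMap_ne_zero {κ : ℂ} (hκ : κ ≠ 0) {p : Polynomial ℂ} (hp : p ≠ 0) :
    RatFunc.C κ * algebraMap (Polynomial ℂ) (RatFunc ℂ) p ≠ 0 := by
  refine mul_ne_zero (by simpa using hκ) ?_
  rwa [ne_eq, map_eq_zero_iff _ (RatFunc.algebraMap_injective ℂ)]

/-- A stable function is constant along a reduction. -/
theorem Reduces.stable_eq {D E : GammaData} {p : Polynomial ℂ} (h : Reduces D p E)
    {Istar : RatFunc ℂ → GammaData → ℂ} (hm : StableMultiplication Istar)
    (hf : StableFactorial Istar) {κ : ℂ} (hκ : κ ≠ 0) :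
    Istar (RatFunc.C κ) D = Istar (RatFunc.C κ * algebraMap _ _ p) E := by
  induction h with
  | refl => simp
  | mult h1 h2 ih => exact ih.trans (hm _ (C_mul_algebraMap_ne_zero hκ h1.ne_zero) _ _ h2)
  | @expand p E E' l μ S h h1 h2 h3 h4 ih =>
    exact ih.trans (hf _ _ (C_mul_algebraMap_ne_zero hκ h.ne_zero)
      (C_mul_algebraMap_ne_zero hκ (h.expand l μ S h1 h2 h3 h4).ne_zero) _ _
      (Or.inl (expandingStep_of_factors h1 h2 h3 h4 κ p)))

theorem GammaData.gammaFactor_eq (D : GammaData) (s : ℂ) : D.gammaFactor s =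
    (D.Q : ℂ) ^ s * (D.factors.map fun p => Complex.Gamma ((p.1 : ℂ) * s + p.2)).prod := by
  rw [D.map_factors]; rfl

theorem re_linear_pos {l : ℝ} {μ s : ℂ} (hl : 0 < l) (hμ : 0 ≤ μ.re) (hs : 0 < s.re) :
    0 < ((l : ℂ) * s + μ).re := by
  simp only [Complex.add_re, Complex.re_ofReal_mul]
  positivity

/-- The multiplication formula for `γ`-factors, up to a positive constant. -/
theorem MultiplicationStep.gammaFactor_eq {D D' : GammaData} (h : MultiplicationStep D D') :
    ∃ c : ℂ, c ≠ 0 ∧ D'.ω = D.ω * (conj c / c) ∧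
      ∀ s : ℂ, 0 < s.re → D.gammaFactor s = c * D'.gammaFactor s := by
  obtain ⟨m, l, μ, S, c, hm, hD, hD', hc, hQ, hω⟩ := h
  have hm0 : (0 : ℝ) < m := by positivity
  have hm1 : (m : ℂ) ≠ 0 := by exact_mod_cast hm0.ne'
  have hl : 0 < l := D.lam_pos_of_mem (p := (l, μ)) (by simp [hD])
  have hμ : 0 ≤ μ.re := D.mu_re_nonneg_of_mem (p := (l, μ)) (by simp [hD])
  obtain ⟨C, hC, hG⟩ := exists_gauss_multiplication hm
  obtain ⟨t, ht, htc⟩ := gauss_constant_eq m μ hm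
  refine ⟨(C : ℂ) * (m : ℂ) ^ μ, mul_ne_zero (by exact_mod_cast hC.ne')
    (by simp [Complex.cpow_eq_zero_iff, hm1]), ?_, fun s hs => ?_⟩
  · rw [hω, mul_div_assoc, hc, htc, conj_div_of_pos_mul ht, conj_div_of_pos_mul hC]
  · have hz := hG _ (re_linear_pos hl hμ hs)
    have hpr : ∏ k ∈ Finset.range m, Complex.Gamma (((l : ℂ) * s + μ + k) / m) =
        ((Multiset.range m).map fun k : ℕ =>
          Complex.Gamma (((l / m : ℝ) : ℂ) * s + (μ + k) / m)).prod := by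
      have e : ∀ k : ℕ, ((l : ℂ) * s + μ + k) / m = ((l / m : ℝ) : ℂ) * s + (μ + k) / m := by
        intro k; push_cast; ring
      simp only [e]; rfl
    have hQs : ((D.Q * (m : ℝ) ^ l : ℝ) : ℂ) ^ s = (D.Q : ℂ) ^ s * (m : ℂ) ^ ((l : ℂ) * s) := by
      have hml := Real.rpow_pos_of_pos hm0 l
      rw [Complex.ofReal_mul, Complex.mul_cpow_ofReal_nonneg D.Q_pos.le hml.le,
        Complex.cpow_def_of_ne_zero (x := (((m : ℝ) ^ l : ℝ) : ℂ)) (by exact_mod_cast hml.ne'),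
        ← Complex.ofReal_log hml.le,
        Real.log_rpow hm0, Complex.cpow_def_of_ne_zero hm1, ← Complex.ofReal_natCast m,
        ← Complex.ofReal_log hm0.le]
      push_cast
      ring_nf
    rw [GammaData.gammaFactor_eq, GammaData.gammaFactor_eq, hD, hD', hQ, hQs]
    simp only [Multiset.map_add, Multiset.map_cons, Multiset.map_map, Function.comp_def,
      Multiset.prod_add, Multiset.prod_cons]
    rw [← hpr, hz, Complex.cpow_add _ _ hm1]
    ring

/-- Along a reduction, `γ_D` and `p γ_E` agree up to a constant `c`, which accounts for the change
of `ω`. -/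
theorem Reduces.gammaFactor_eq {D E : GammaData} {p : Polynomial ℂ} (h : Reduces D p E) :
    ∃ c : ℂ, c ≠ 0 ∧ E.ω = D.ω * (conj c / c) ∧
      ∀ s : ℂ, 0 < s.re → D.gammaFactor s = c * (p.eval s * E.gammaFactor s) := by
  induction h with
  | refl => exact ⟨1, one_ne_zero, by simp, fun s _ => by simp⟩
  | @mult p E E' h1 h2 ih =>
    obtain ⟨c, hc, hω, hs⟩ := ih
    obtain ⟨c', hc', hω', hs'⟩ := h2.gammaFactor_eq
    refine ⟨c * c', mul_ne_zero hc hc', ?_, fun s h => ?_⟩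
    · rw [hω', hω, map_mul]; field_simp
    · rw [hs s h, hs' s h]; ring
  | @expand p E E' l μ S h h1 h2 h3 h4 ih =>
    obtain ⟨c, hc, hω, hs⟩ := ih
    refine ⟨c, hc, h4.trans hω, fun s h => ?_⟩
    have hl : 0 < l := E'.lam_pos_of_mem (p := (l, μ - 1)) (by simp [h2])
    have hμ : 0 ≤ (μ - 1).re := E'.mu_re_nonneg_of_mem (p := (l, μ - 1)) (by simp [h2])
    have hz := re_linear_pos hl hμ h
    have hΓ := Complex.Gamma_add_one ((l : ℂ) * s + (μ - 1)) (fun h0 => by simp [h0] at hz)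
    rw [show (l : ℂ) * s + (μ - 1) + 1 = l * s + μ by ring] at hΓ
    rw [hs s h, GammaData.gammaFactor_eq, GammaData.gammaFactor_eq, h1, h2, h3]
    simp only [Multiset.map_cons, Multiset.prod_cons, hΓ, Polynomial.eval_mul, Polynomial.eval_add,
      Polynomial.eval_C, Polynomial.eval_X]
    ring

open Classical in
/-- The order of the pole of `Γ(l s + μ)` at `s = -ρ`. -/
noncomputable def poleOrder (ρ : ℂ) (p : ℝ × ℂ) : ℕ :=
  if ∃ k : ℕ, (p.1 : ℂ) * ρ = p.2 + k then 1 else 0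

/-- The order of the pole of `γ_D` at `s = -ρ`. -/
noncomputable def GammaData.poleCount (D : GammaData) (ρ : ℂ) : ℕ :=
  (D.factors.map (poleOrder ρ)).sum

theorem poleOrder_multiplication (ρ : ℂ) (l : ℝ) (μ : ℂ) {m : ℕ} (hm : 1 ≤ m) :
    ∑ k ∈ Finset.range m, poleOrder ρ (l / (m : ℝ), (μ + (k : ℂ)) / (m : ℂ)) =
      poleOrder ρ (l, μ) := by
  have hm1 : (m : ℂ) ≠ 0 := by exact_mod_cast (by omega : m ≠ 0)
  have key : ∀ k k' : ℕ, (((l / (m : ℝ) : ℝ) : ℂ) * ρ = (μ + (k : ℂ)) / (m : ℂ) + k' ↔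
      (l : ℂ) * ρ = μ + ((k + m * k' : ℕ) : ℂ)) := by
    intro k k'
    push_cast
    constructor <;> intro h <;> field_simp at h ⊢ <;> linear_combination h
  classical
  unfold poleOrder
  by_cases h : ∃ K : ℕ, (l : ℂ) * ρ = μ + K
  · obtain ⟨K, hK⟩ := h
    have e : ∀ k ∈ Finset.range m,
        (∃ k' : ℕ, ((l / (m : ℝ) : ℝ) : ℂ) * ρ =
        (μ + (k : ℂ)) / (m : ℂ) + k') ↔ k = K % m := by
      intro k hk
      have hk := Finset.mem_range.1 hk
      rw [exists_congr (key k)]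
      constructor
      · rintro ⟨k', h'⟩
        have : K = k + m * k' := by exact_mod_cast add_left_cancel (hK.symm.trans h')
        rw [this, Nat.add_mul_mod_self_left, Nat.mod_eq_of_lt hk]
      · rintro rfl
        exact ⟨K / m, by rw [Nat.mod_add_div, hK]⟩
    rw [Finset.sum_congr rfl (fun k hk => if_congr (e k hk) rfl rfl), if_pos ⟨K, hK⟩,
      Finset.sum_ite_eq', if_pos (Finset.mem_range.2 (Nat.mod_lt _ hm))]
  · rw [if_neg h]
    refine Finset.sum_eq_zero fun k _ => if_neg ?_
    rintro ⟨k', h'⟩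
    exact h ⟨_, (key _ _).1 h'⟩

theorem poleOrder_sub_one (ρ : ℂ) {l : ℝ} (hl : l ≠ 0) (μ : ℂ) :
    poleOrder ρ (l, μ - 1) = poleOrder ρ (l, μ) + Multiset.count (-ρ) {-((μ - 1) / l)} := by
  have hl1 : (l : ℂ) ≠ 0 := by exact_mod_cast hl
  have e : (-ρ = -((μ - 1) / l)) ↔ (l : ℂ) * ρ = μ - 1 := by
    rw [neg_inj, eq_div_iff hl1, mul_comm]
  classical
  simp only [poleOrder, Multiset.count_singleton, e]
  by_cases h0 : (l : ℂ) * ρ = μ - 1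
  · have h1 : ¬ ∃ k : ℕ, (l : ℂ) * ρ = μ + k := by
      rintro ⟨k, hk⟩
      have : ((k + 1 : ℕ) : ℂ) = 0 := by push_cast; linear_combination h0 - hk
      exact absurd (Nat.cast_eq_zero.1 this) (by omega)
    rw [if_neg h1, if_pos h0, if_pos ⟨0, by simpa using h0⟩]
  · rw [if_neg h0, add_zero]
    refine if_congr ⟨?_, ?_⟩ rfl rfl
    · rintro ⟨k, hk⟩
      rcases k with _ | k
      · exact absurd (by simpa using hk) h0
      · exact ⟨k, by rw [hk]; push_cast; ring⟩
    · rintro ⟨k, hk⟩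
      exact ⟨k + 1, by rw [hk]; push_cast; ring⟩

/-- The poles of `p γ_E` are those of `γ_D`, with multiplicity. -/
theorem Reduces.poleCount_eq {D E : GammaData} {p : Polynomial ℂ} (h : Reduces D p E) (ρ : ℂ) :
    E.poleCount ρ = D.poleCount ρ + p.roots.count (-ρ) := by
  induction h with
  | refl => simp
  | @mult p E E' h1 h2 ih =>
    rw [← ih]
    obtain ⟨m, l, μ, S, c, hm, hD, hD', -⟩ := h2
    unfold GammaData.poleCount
    rw [hD, hD', Multiset.map_add, Multiset.sum_add, Multiset.map_cons, Multiset.sum_cons,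
      ← poleOrder_multiplication ρ l μ hm]
    simp only [Multiset.map_map, Function.comp_def]
    rfl
  | @expand p E E' l μ S h h1 h2 h3 h4 ih =>
    have hl : 0 < l := E.lam_pos_of_mem (p := (l, μ)) (by simp [h1])
    have hl1 : (l : ℂ) ≠ 0 := by exact_mod_cast hl.ne'
    have hne := (h.expand l μ S h1 h2 h3 h4).ne_zero
    rw [Polynomial.roots_mul hne, Polynomial.roots_C_mul_X_add_C _ hl1, Multiset.count_add,
      show -((l : ℂ)⁻¹ * (μ - 1)) = -((μ - 1) / l) by rw [div_eq_inv_mul]]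
    unfold GammaData.poleCount at ih ⊢
    rw [h1, Multiset.map_cons, Multiset.sum_cons] at ih
    rw [h2, Multiset.map_cons, Multiset.sum_cons, poleOrder_sub_one ρ hl.ne']
    omega

theorem exists_gammaData {ω : ℂ} (hω : ‖ω‖ = 1) {Q : ℝ} (hQ : 0 < Q) (S : Multiset (ℝ × ℂ))
    (hS : ∀ p ∈ S, 0 < p.1 ∧ 0 ≤ p.2.re) :
    ∃ D : GammaData, D.ω = ω ∧ D.Q = Q ∧ D.factors = S := by
  refine ⟨⟨ω, Q, S.toList.length, fun j => (S.toList.get j).1, fun j => (S.toList.get j).2, hω, hQ,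
    fun j => (hS _ ?_).1, fun j => (hS _ ?_).2⟩, rfl, rfl, ?_⟩
  · exact Multiset.mem_toList.1 (List.get_mem _ _)
  · exact Multiset.mem_toList.1 (List.get_mem _ _)
  · conv_rhs => rw [← S.coe_toList]
    simp only [GammaData.factors, Prod.mk.eta]
    rw [Fin.univ_val_map, List.ofFn_get]

/-- The multiset `S` of Gamma factors can be reached from `D` by a reduction. -/
def Reachable (D : GammaData) (S : Multiset (ℝ × ℂ)) : Prop :=
  ∃ p E, Reduces D p E ∧ E.factors = S

theorem Reachable.multiplication {D : GammaData} {l : ℝ} {μ : ℂ} {S : Multiset (ℝ × ℂ)}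
    (h : Reachable D ((l, μ) ::ₘ S)) {m : ℕ} (hm : 1 ≤ m) :
    Reachable D
      ((Multiset.range m).map (fun k : ℕ => (l / (m : ℝ), (μ + (k : ℂ)) / (m : ℂ))) + S) := by
  obtain ⟨p, E, hE, hS⟩ := h
  have hm0 : (0 : ℝ) < m := by positivity
  have hl : 0 < l := E.lam_pos_of_mem (p := (l, μ)) (by simp [hS])
  have hμ : 0 ≤ μ.re := E.mu_re_nonneg_of_mem (p := (l, μ)) (by simp [hS])
  obtain ⟨c, hc⟩ :
      ∃ c, c = (m : ℂ) ^ (μ - 1 / 2) * (2 * (Real.pi : ℂ)) ^ ((1 - (m : ℂ)) / 2) := ⟨_, rfl⟩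
  have hc0 : c ≠ 0 := by
    have : (m : ℂ) ≠ 0 := by exact_mod_cast hm0.ne'
    simp [hc, Complex.cpow_eq_zero_iff, this, Real.pi_ne_zero]
  obtain ⟨E', h1, h2, h3⟩ := exists_gammaData (ω := E.ω * conj c / c)
    (by rw [norm_div, norm_mul, E.norm_ω, one_mul, RCLike.norm_conj,
      div_self (norm_ne_zero_iff.2 hc0)])
    (Q := E.Q * (m : ℝ) ^ l) (mul_pos E.Q_pos (Real.rpow_pos_of_pos hm0 _))
    ((Multiset.range m).map (fun k : ℕ => (l / (m : ℝ), (μ + (k : ℂ)) / (m : ℂ))) + S) (by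
      intro q hq
      rcases Multiset.mem_add.1 hq with hq | hq
      · obtain ⟨k, -, rfl⟩ := Multiset.mem_map.1 hq
        refine ⟨by positivity, ?_⟩
        rw [← Complex.ofReal_natCast m, Complex.div_ofReal_re]
        simp only [Complex.add_re, Complex.natCast_re]
        positivity
      · have : q ∈ E.factors := by rw [hS]; exact Multiset.mem_cons_of_mem hq
        exact ⟨E.lam_pos_of_mem this, E.mu_re_nonneg_of_mem this⟩)
  exact ⟨p, E', hE.mult ⟨m, l, μ, S, c, hm, hS, h3, hc, h2, h1⟩, h3⟩

theorem Reachable.expand {D : GammaData} {l : ℝ} {μ : ℂ} {S : Multiset (ℝ × ℂ)}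
    (h : Reachable D ((l, μ) ::ₘ S)) (hμ : 1 ≤ μ.re) : Reachable D ((l, μ - 1) ::ₘ S) := by
  obtain ⟨p, E, hE, hS⟩ := h
  have hl : 0 < l := E.lam_pos_of_mem (p := (l, μ)) (by simp [hS])
  obtain ⟨E', h1, h2, h3⟩ := exists_gammaData E.norm_ω E.Q_pos ((l, μ - 1) ::ₘ S) (by
    intro q hq
    rcases Multiset.mem_cons.1 hq with rfl | hq
    · exact ⟨hl, by simpa using hμ⟩
    · have : q ∈ E.factors := by rw [hS]; exact Multiset.mem_cons_of_mem hq
      exact ⟨E.lam_pos_of_mem this, E.mu_re_nonneg_of_mem this⟩)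
  exact ⟨_, E', hE.expand l μ S hS h3 h2 h1, h3⟩

/-- Translate `μ` by an integer into the strip `0 ≤ Re μ < 1` (for `Re μ ≥ 0`). -/
noncomputable def toStrip (p : ℝ × ℂ) : ℝ × ℂ := (p.1, p.2 - (⌊p.2.re⌋₊ : ℂ))

theorem Reachable.toStrip_cons {D : GammaData} {a : ℝ × ℂ} {S : Multiset (ℝ × ℂ)}
    (h : Reachable D (a ::ₘ S)) : Reachable D (toStrip a ::ₘ S) := by
  have ha : 0 ≤ a.2.re := by
    obtain ⟨p, E, hE, hS⟩ := h
    exact E.mu_re_nonneg_of_mem (by simp [hS])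
  have key : ∀ n : ℕ, (n : ℝ) ≤ a.2.re → Reachable D ((a.1, a.2 - (n : ℂ)) ::ₘ S) := by
    intro n
    induction n with
    | zero => intro _; simpa using h
    | succ n ih =>
      intro hn
      push_cast at hn ⊢
      have := (ih (by linarith)).expand (by simp; linarith)
      rwa [sub_sub] at this
  exact key _ (Nat.floor_le ha)

theorem Reachable.map_toStrip_add {D : GammaData} (X : Multiset (ℝ × ℂ)) :
    ∀ {T : Multiset (ℝ × ℂ)}, Reachable D (X + T) → Reachable D (X.map toStrip + T) := by
  induction X using Multiset.induction_on with
  | empty => intro T h; simpa using h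
  | cons a X ih =>
    intro T h
    rw [Multiset.cons_add] at h
    have h1 := h.toStrip_cons
    rw [← Multiset.add_cons] at h1
    have h2 := ih h1
    rwa [Multiset.add_cons, ← Multiset.cons_add, ← Multiset.map_cons] at h2

/-- Split `Γ(l s + μ)` by the multiplication formula into `m l` factors and move them into the
strip. -/
noncomputable def splitToStrip (m : ℝ → ℕ) (p : ℝ × ℂ) : Multiset (ℝ × ℂ) :=
  ((Multiset.range (m p.1)).map
    (fun k : ℕ => (p.1 / (m p.1 : ℝ), (p.2 + (k : ℂ)) / (m p.1 : ℂ)))).map toStrip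

theorem Reachable.bind_splitToStrip_add {D : GammaData} (m : ℝ → ℕ) (X : Multiset (ℝ × ℂ)) :
    ∀ {T : Multiset (ℝ × ℂ)}, (∀ p ∈ X, 1 ≤ m p.1) → Reachable D (X + T) →
      Reachable D (X.bind (splitToStrip m) + T) := by
  induction X using Multiset.induction_on with
  | empty => intro T _ h; simpa using h
  | cons a X ih =>
    intro T hX h
    rw [Multiset.cons_add] at h
    have h1 := (h.multiplication (l := a.1) (μ := a.2)
      (hX a (Multiset.mem_cons_self a X))).map_toStrip_add
    rw [add_left_comm] at h1
    have h2 := ih (fun p hp => hX p (Multiset.mem_cons_of_mem hp)) h1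
    rwa [add_left_comm, ← add_assoc, ← splitToStrip, ← Multiset.cons_bind] at h2

/-- Finitely many positive reals can be divided by positive integers so that commensurable ones
become equal. -/
theorem exists_common_measure (A : Finset ℝ) (hA : ∀ a ∈ A, 0 < a) : ∃ m : ℝ → ℕ,
    (∀ a ∈ A, 1 ≤ m a) ∧ ∀ a ∈ A, ∀ b ∈ A,
      (∃ q : ℚ, a / (m a : ℝ) = q * (b / (m b : ℝ))) → a / (m a : ℝ) = b / (m b : ℝ) := by
  classical
  let st : Setoid ℝ :=
    { r := fun a b => ∃ q : ℚ, q ≠ 0 ∧ a = q * b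
      iseqv := by
        refine ⟨fun a => ⟨1, one_ne_zero, by simp⟩, ?_, ?_⟩
        · rintro a b ⟨q, hq, rfl⟩
          have : (q : ℝ) ≠ 0 := by exact_mod_cast hq
          exact ⟨q⁻¹, inv_ne_zero hq, by push_cast; field_simp⟩
        · rintro a b c ⟨q, hq, rfl⟩ ⟨q', hq', rfl⟩
          exact ⟨q * q', mul_ne_zero hq hq', by push_cast; ring⟩ }
  let rep : ℝ → ℝ := fun a => (Quotient.mk st a).out
  have hrep : ∀ a, ∃ q : ℚ, q ≠ 0 ∧ a = q * rep a := fun a =>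
    st.symm (Quotient.mk_out (s := st) a)
  choose q hq0 hq using hrep
  let B : ℕ := ∏ a ∈ A, (q a).den
  have hB : 0 < B := Finset.prod_pos fun a _ => (q a).den_pos
  -- `m a = |q a| B`, hence `a / m a = |rep a| / B` depends on the class of `a` only.
  let m : ℝ → ℕ := fun a => (q a).num.natAbs * (B / (q a).den)
  have hm : ∀ a ∈ A, (m a : ℝ) = |(q a : ℝ)| * B := by
    intro a ha
    have hd : (q a).den ∣ B := Finset.dvd_prod_of_mem _ ha
    have hden : ((q a).den : ℝ) ≠ 0 := by exact_mod_cast (q a).den_nz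
    have h1 : ((B / (q a).den : ℕ) : ℝ) = B / (q a).den := Nat.cast_div hd hden
    have h2 : |(q a : ℝ)| = ((q a).num.natAbs : ℝ) / (q a).den := by
      conv_lhs => rw [Rat.cast_def, abs_div, Nat.abs_cast]
      rw [Nat.cast_natAbs, Int.cast_abs]
    simp only [m]
    rw [Nat.cast_mul, h1, h2]
    ring
  have hquot : ∀ a ∈ A, a / (m a : ℝ) = |rep a| / B := by
    intro a ha
    have hqa : |(q a : ℝ)| ≠ 0 := by simpa using hq0 a
    have : a = |(q a : ℝ)| * |rep a| := by
      rw [← abs_mul, ← hq a, abs_of_pos (hA a ha)]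
    calc a / (m a : ℝ) = |(q a : ℝ)| * |rep a| / (|(q a : ℝ)| * B) := by rw [← this, hm a ha]
      _ = |rep a| / B := mul_div_mul_left _ _ hqa
  have hm1 : ∀ a ∈ A, 1 ≤ m a := by
    intro a ha
    refine Nat.mul_pos (Int.natAbs_pos.2 (by simpa using hq0 a)) ?_
    exact Nat.div_pos (Nat.le_of_dvd hB (Finset.dvd_prod_of_mem _ ha)) (q a).den_pos
  refine ⟨m, hm1, ?_⟩
  rintro a ha b hb ⟨t, ht⟩
  rw [hquot a ha, hquot b hb]
  have hma : (m a : ℝ) ≠ 0 := by exact_mod_cast (Nat.pos_iff_ne_zero.1 (hm1 a ha))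
  have hmb : (m b : ℝ) ≠ 0 := by exact_mod_cast (Nat.pos_iff_ne_zero.1 (hm1 b hb))
  have hab : st.r a b := by
    refine ⟨t * m a / m b, ?_, ?_⟩
    · rintro h0
      have : (a : ℝ) = ((t * m a / m b : ℚ) : ℝ) * b := by
        push_cast; field_simp at ht ⊢; linear_combination ht
      rw [h0] at this
      simp at this
      exact (hA a ha).ne' this
    · push_cast; field_simp at ht ⊢; linear_combination ht
  have : rep a = rep b := by
    simp only [rep]
    rw [Quotient.sound (s := st) hab]
  rw [this]

/-- For large `K`, the point `(μ + K) / l` is a pole (up to sign) of no Gamma factor in the strip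
except `Γ(l s + μ)` itself. -/
theorem eventually_poleOrder_eq {a b : ℝ × ℂ} (ha : 0 < a.1) (hb : 0 < b.1) (ha0 : 0 ≤ a.2.re)
    (ha1 : a.2.re < 1) (hb0 : 0 ≤ b.2.re) (hb1 : b.2.re < 1)
    (hab : (∃ q : ℚ, b.1 = q * a.1) → b.1 = a.1) :
    ∀ᶠ K : ℕ in Filter.atTop, poleOrder ((a.2 + K) / a.1) b = Multiset.count a {b} := by
  classical
  have ha' : (a.1 : ℂ) ≠ 0 := by exact_mod_cast ha.ne'
  by_cases h1 : b.1 = a.1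
  · refine Filter.Eventually.of_forall fun K => ?_
    rw [poleOrder, Multiset.count_singleton, h1, mul_div_cancel₀ _ ha']
    refine if_congr ⟨?_, ?_⟩ rfl rfl
    · rintro ⟨k, hk⟩
      have hre := congrArg Complex.re hk
      simp only [Complex.add_re, Complex.natCast_re] at hre
      have hKk : K = k := by
        have u1 : (K : ℝ) < k + 1 := by linarith
        have u2 : (k : ℝ) < K + 1 := by linarith
        have u1' : K < k + 1 := by exact_mod_cast u1
        have u2' : k < K + 1 := by exact_mod_cast u2
        omega
      rw [hKk] at hk
      exact Prod.ext h1.symm (add_right_cancel hk)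
    · rintro rfl
      exact ⟨K, rfl⟩
  · -- two coincidences would make `b.1 / a.1` rational
    have h2 : ∀ᶠ K : ℕ in Filter.atTop, ¬ ∃ k : ℕ, (b.1 : ℂ) * ((a.2 + K) / a.1) = b.2 + k := by
      by_cases h3 : ∃ K₀ k₀ : ℕ, (b.1 : ℂ) * ((a.2 + K₀) / a.1) = b.2 + k₀
      · obtain ⟨K₀, k₀, h3⟩ := h3
        filter_upwards [Filter.eventually_gt_atTop K₀] with K hK
        rintro ⟨k, hk⟩
        refine h1 (hab ⟨((k : ℚ) - k₀) / ((K : ℚ) - K₀), ?_⟩)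
        have hKne : ((K : ℝ) - K₀) ≠ 0 := sub_ne_zero.2 (by exact_mod_cast hK.ne')
        have e : (b.1 : ℂ) * ((K : ℂ) - K₀) = ((k : ℂ) - k₀) * a.1 := by
          field_simp at h3 hk
          linear_combination hk - h3
        have e' : b.1 * ((K : ℝ) - K₀) = ((k : ℝ) - k₀) * a.1 := by exact_mod_cast e
        push_cast
        field_simp
        linear_combination e'
      · push Not at h3
        exact Filter.Eventually.of_forall fun K => by push Not; exact h3 K
    filter_upwards [h2] with K hK
    rw [poleOrder, if_neg hK, Multiset.count_singleton, if_neg]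
    rintro rfl
    exact h1 rfl

theorem sum_map_count_singleton {α : Type*} [DecidableEq α] (a : α) (S : Multiset α) :
    (S.map fun b => Multiset.count a {b}).sum = S.count a := by
  induction S using Multiset.induction_on with
  | empty => simp
  | cons b S ih => rw [Multiset.map_cons, Multiset.sum_cons, ih, Multiset.count_cons,
      Multiset.count_singleton, add_comm]

/-- Gamma factors in the strip, with commensurable `l` equal, are determined by all but finitely
many of their poles. -/
theorem factors_eq_of_poleOrder_eq {S T : Multiset (ℝ × ℂ)} (hpos : ∀ a ∈ S + T, 0 < a.1)
    (hstrip : ∀ a ∈ S + T, 0 ≤ a.2.re ∧ a.2.re < 1)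
    (hcomm : ∀ a ∈ S + T, ∀ b ∈ S + T, (∃ q : ℚ, b.1 = q * a.1) → b.1 = a.1)
    (h : ∀ᶠ ρ in Filter.cofinite, (S.map (poleOrder ρ)).sum = (T.map (poleOrder ρ)).sum) :
    S = T := by
  classical
  ext a
  by_cases ha : a ∈ S + T
  · have h1 : ∀ᶠ K : ℕ in Filter.atTop, ∀ b ∈ (S + T).toFinset,
        poleOrder ((a.2 + K) / a.1) b = Multiset.count a {b} := by
      rw [Filter.eventually_all_finset]
      intro b hb
      have hb := Multiset.mem_toFinset.1 hb
      exact eventually_poleOrder_eq (hpos a ha) (hpos b hb) (hstrip a ha).1 (hstrip a ha).2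
        (hstrip b hb).1 (hstrip b hb).2 (hcomm a ha b hb)
    have ha' : (a.1 : ℂ) ≠ 0 := by exact_mod_cast (hpos a ha).ne'
    have hinj : Function.Injective fun K : ℕ => (a.2 + K) / (a.1 : ℂ) := by
      intro K K' hK
      simp only at hK
      rw [div_left_inj' ha'] at hK
      exact_mod_cast add_left_cancel hK
    have h2 := hinj.tendsto_cofinite.eventually h
    rw [Nat.cofinite_eq_atTop] at h2
    obtain ⟨K, hK1, hK2⟩ := (h1.and h2).exists
    rw [Multiset.map_congr rfl (fun b hb => hK1 b (by simp [hb])),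
      Multiset.map_congr (s := T) rfl (fun b hb => hK1 b (by simp [hb])),
      sum_map_count_singleton, sum_map_count_singleton] at hK2
    exact hK2
  · rw [Multiset.mem_add, not_or] at ha
    rw [Multiset.count_eq_zero_of_notMem ha.1, Multiset.count_eq_zero_of_notMem ha.2]

theorem mem_splitToStrip {m : ℝ → ℕ} {p a : ℝ × ℂ} (hp : 0 ≤ p.2.re) (ha : a ∈ splitToStrip m p) :
    a.1 = p.1 / (m p.1 : ℝ) ∧ 0 ≤ a.2.re ∧ a.2.re < 1 := by
  simp only [splitToStrip, Multiset.map_map, Multiset.mem_map, Function.comp] at ha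
  obtain ⟨k, -, rfl⟩ := ha
  have h0 : 0 ≤ ((p.2 + (k : ℂ)) / (m p.1 : ℂ)).re := by
    rw [← Complex.ofReal_natCast (m p.1), Complex.div_ofReal_re]
    simp only [Complex.add_re, Complex.natCast_re]
    positivity
  refine ⟨rfl, ?_, ?_⟩ <;> simp only [toStrip, Complex.sub_re, Complex.natCast_re]
  · linarith [Nat.floor_le h0]
  · linarith [Nat.lt_floor_add_one ((p.2 + (k : ℂ)) / (m p.1 : ℂ)).re]

/-- If `γ_D` and `γ_{D'}` have the same poles, both reduce to products with the same Gamma factors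
and with polynomials that differ by a positive constant. -/
theorem exists_common_reduction {D D' : GammaData} (h : ∀ ρ, D.poleCount ρ = D'.poleCount ρ) :
    ∃ (p p' : Polynomial ℂ) (E E' : GammaData) (κ : ℝ), 0 < κ ∧ Reduces D p E ∧ Reduces D' p' E' ∧
      E.factors = E'.factors ∧ p = Polynomial.C (κ : ℂ) * p' := by
  classical
  obtain ⟨m, hm1, hm2⟩ := exists_common_measure ((D.factors + D'.factors).map Prod.fst).toFinset (by
    intro a ha
    simp only [Multiset.mem_toFinset, Multiset.mem_map, Multiset.mem_add] at ha
    obtain ⟨b, hb | hb, rfl⟩ := ha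
    · exact D.lam_pos_of_mem hb
    · exact D'.lam_pos_of_mem hb)
  have hmem : ∀ b ∈ D.factors + D'.factors,
      b.1 ∈ ((D.factors + D'.factors).map Prod.fst).toFinset := by
    intro b hb
    exact Multiset.mem_toFinset.2 (Multiset.mem_map_of_mem _ hb)
  have reach : ∀ D₀ : GammaData, (∀ b ∈ D₀.factors, b ∈ D.factors + D'.factors) →
      Reachable D₀ (D₀.factors.bind (splitToStrip m)) := by
    intro D₀ hD₀
    have h0 : Reachable D₀ (D₀.factors + 0) := ⟨1, D₀, .refl, by simp⟩
    simpa using Reachable.bind_splitToStrip_add m D₀.factors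
      (fun b hb => hm1 _ (hmem b (hD₀ b hb))) h0
  obtain ⟨p, E, hE, hS⟩ := reach D fun b hb => Multiset.mem_add.2 (Or.inl hb)
  obtain ⟨p', E', hE', hS'⟩ := reach D' fun b hb => Multiset.mem_add.2 (Or.inr hb)
  have hfrom : ∀ a ∈ E.factors + E'.factors, ∃ b ∈ D.factors + D'.factors,
      0 ≤ b.2.re ∧ a ∈ splitToStrip m b := by
    intro a ha
    rw [hS, hS', Multiset.mem_add, Multiset.mem_bind, Multiset.mem_bind] at ha
    rcases ha with ⟨b, hb, hab⟩ | ⟨b, hb, hab⟩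
    · exact ⟨b, Multiset.mem_add.2 (Or.inl hb), D.mu_re_nonneg_of_mem hb, hab⟩
    · exact ⟨b, Multiset.mem_add.2 (Or.inr hb), D'.mu_re_nonneg_of_mem hb, hab⟩
  have hfac : E.factors = E'.factors := by
    refine factors_eq_of_poleOrder_eq ?_ ?_ ?_ ?_
    · intro a ha
      rcases Multiset.mem_add.1 ha with ha | ha
      · exact E.lam_pos_of_mem ha
      · exact E'.lam_pos_of_mem ha
    · intro a ha
      obtain ⟨b, -, hb0, hab⟩ := hfrom a ha
      exact (mem_splitToStrip hb0 hab).2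
    · intro a ha a' ha'
      obtain ⟨b, hb, hb0, hab⟩ := hfrom a ha
      obtain ⟨b', hb', hb0', hab'⟩ := hfrom a' ha'
      rw [(mem_splitToStrip hb0 hab).1, (mem_splitToStrip hb0' hab').1]
      exact hm2 _ (hmem b' hb') _ (hmem b hb)
    · have hfin : ∀ r : Polynomial ℂ, ∀ᶠ ρ in Filter.cofinite, r.roots.count (-ρ) = 0 := by
        intro r
        have : (Neg.neg ⁻¹' (r.roots.toFinset : Set ℂ)).Finite :=
          r.roots.toFinset.finite_toSet.preimage neg_injective.injOn
        filter_upwards [this.compl_mem_cofinite] with ρ hρ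
        rw [Multiset.count_eq_zero]
        simpa using hρ
      filter_upwards [hfin p, hfin p'] with ρ h1 h2
      have e1 := hE.poleCount_eq ρ
      have e2 := hE'.poleCount_eq ρ
      rw [h1, add_zero] at e1
      rw [h2, add_zero] at e2
      exact e1.trans ((h ρ).trans e2.symm)
  have hroots : p.roots = p'.roots := by
    ext x
    have e1 := hE.poleCount_eq (-x)
    have e2 := hE'.poleCount_eq (-x)
    have e3 : E.poleCount (-x) = E'.poleCount (-x) := by unfold GammaData.poleCount; rw [hfac]
    rw [neg_neg] at e1 e2
    have := h (-x)
    omega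
  obtain ⟨t, ht, et⟩ := hE.leadingCoeff_pos
  obtain ⟨t', ht', et'⟩ := hE'.leadingCoeff_pos
  refine ⟨p, p', E, E', t / t', div_pos ht ht', hE, hE', hfac, ?_⟩
  have s1 := (IsAlgClosed.splits p).eq_prod_roots
  have s2 := (IsAlgClosed.splits p').eq_prod_roots
  rw [et] at s1
  rw [et'] at s2
  rw [s1, s2, hroots, ← mul_assoc, ← map_mul]
  have : (t' : ℂ) ≠ 0 := by exact_mod_cast ht'.ne'
  congr 2
  push_cast
  rw [div_mul_cancel₀ _ this]

/-! ### The `H`-invariants determine the poles of the `γ`-factor -/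

/-- The homomorphism from the group algebra of `(ℂ, +)` to power series with `t ↦ e^{tX}`. -/
noncomputable def toExpSeries : AddMonoidAlgebra ℂ ℂ →ₐ[ℂ] PowerSeries ℂ :=
  AddMonoidAlgebra.lift ℂ (PowerSeries ℂ) ℂ
    { toFun := fun t => expSeries t.toAdd
      map_one' := expSeries_zero
      map_mul' := fun _ _ => (expSeries_mul _ _).symm }

theorem toExpSeries_single (t b : ℂ) :
    toExpSeries (AddMonoidAlgebra.single t b) = b • expSeries t := by
  simp [toExpSeries, AddMonoidAlgebra.lift_single]

/-- Distinct exponentials are linearly independent. -/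
theorem toExpSeries_injective : Function.Injective toExpSeries := by
  classical
  rw [injective_iff_map_eq_zero]
  intro a ha
  have h1 : ∀ n : ℕ, ∑ t ∈ a.coeff.support, a.coeff t * t ^ n = 0 := by
    intro n
    have h := congrArg (PowerSeries.coeff n) ha
    rw [toExpSeries, AddMonoidAlgebra.lift_apply, Finsupp.sum, map_sum] at h
    simp only [MonoidHom.coe_mk, OneHom.coe_mk, toAdd_ofAdd, map_smul, coeff_expSeries, map_zero,
      smul_eq_mul, ← mul_div_assoc, ← Finset.sum_div] at h
    exact (div_eq_zero_iff.1 h).resolve_right (by exact_mod_cast n.factorial_ne_zero)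
  have h2 : ∀ P : Polynomial ℂ, ∑ t ∈ a.coeff.support, a.coeff t * P.eval t = 0 := by
    intro P
    simp only [Polynomial.eval_eq_sum_range, Finset.mul_sum]
    rw [Finset.sum_comm]
    refine Finset.sum_eq_zero fun n _ => ?_
    rw [← mul_zero (P.coeff n), ← h1 n, Finset.mul_sum]
    exact Finset.sum_congr rfl fun t _ => by ring
  refine AddMonoidAlgebra.ext (Finsupp.ext fun t => ?_)
  by_contra ht
  have hts : t ∈ a.coeff.support := Finsupp.mem_support_iff.2 ht
  -- evaluate at a polynomial vanishing on the support except at `t`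
  have h3 := h2 (∏ t' ∈ a.coeff.support.erase t, (Polynomial.X - Polynomial.C t'))
  simp only [Polynomial.eval_prod, Polynomial.eval_sub, Polynomial.eval_X, Polynomial.eval_C] at h3
  rw [Finset.sum_eq_single_of_mem t hts] at h3
  · refine (mul_ne_zero ht (Finset.prod_ne_zero_iff.2 fun t' ht' => ?_)) h3
    exact sub_ne_zero.2 (Finset.ne_of_mem_erase ht').symm
  · intro t' ht' hne
    rw [Finset.prod_eq_zero (Finset.mem_erase.2 ⟨hne, ht'⟩) (sub_self _), mul_zero]

/-- The action of the group algebra of `(ℂ, +)` on functions by translation. -/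
noncomputable def translationAction : AddMonoidAlgebra ℂ ℂ →ₐ[ℂ] Module.End ℂ (ℂ → ℂ) :=
  AddMonoidAlgebra.lift ℂ (Module.End ℂ (ℂ → ℂ)) ℂ
    { toFun := fun t => LinearMap.funLeft ℂ ℂ fun ρ => ρ - t.toAdd
      map_one' := by ext f ρ; simp [LinearMap.funLeft_apply]
      map_mul' := fun s t => by
        ext f ρ
        simp [LinearMap.funLeft_apply, sub_sub] }

theorem translationAction_single (t : ℂ) (f : ℂ → ℂ) (ρ : ℂ) :
    translationAction (AddMonoidAlgebra.single t 1) f ρ = f (ρ - t) := by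
  simp [translationAction, AddMonoidAlgebra.lift_single, LinearMap.funLeft_apply]

theorem translationAction_mul (a b : AddMonoidAlgebra ℂ ℂ) (f : ℂ → ℂ) :
    translationAction (a * b) f = translationAction a (translationAction b f) := by
  rw [map_mul]; rfl

/-- `a` acts injectively on the functions supported in `Re ρ ≥ 0`, and preserves this space. -/
def InjectiveOnHalfPlane (a : AddMonoidAlgebra ℂ ℂ) : Prop :=
  ∀ f : ℂ → ℂ, (∀ ρ, ρ.re < 0 → f ρ = 0) →
    (∀ ρ, ρ.re < 0 → translationAction a f ρ = 0) ∧ (translationAction a f = 0 → f = 0)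

theorem InjectiveOnHalfPlane.mul {a b : AddMonoidAlgebra ℂ ℂ} (ha : InjectiveOnHalfPlane a)
    (hb : InjectiveOnHalfPlane b) : InjectiveOnHalfPlane (a * b) := by
  intro f hf
  rw [translationAction_mul]
  obtain ⟨h1, h2⟩ := hb f hf
  obtain ⟨h3, h4⟩ := ha _ h1
  exact ⟨h3, fun h => h2 (h4 h)⟩

theorem injectiveOnHalfPlane_single_sub_one {t : ℝ} (ht : 0 < t) :
    InjectiveOnHalfPlane (AddMonoidAlgebra.single (t : ℂ) 1 - 1) := by
  have e : ∀ (f : ℂ → ℂ) (ρ : ℂ), translationAction (AddMonoidAlgebra.single (t : ℂ) 1 - 1) f ρ =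
      f (ρ - t) - f ρ := by
    intro f ρ
    rw [map_sub, map_one, LinearMap.sub_apply, Pi.sub_apply, translationAction_single]
    rfl
  intro f hf
  refine ⟨fun ρ hρ => ?_, fun h => funext fun ρ => ?_⟩
  · rw [e, hf ρ hρ, hf _ (by simp; linarith), sub_zero]
  · have h1 : ∀ ρ, f (ρ - t) = f ρ := fun ρ => sub_eq_zero.1 ((e f ρ).symm.trans (congrFun h ρ))
    have h2 : ∀ n : ℕ, f (ρ - n * t) = f ρ := by
      intro n
      induction n with
      | zero => simp
      | succ n ih => rw [← ih, ← h1 (ρ - n * t)]; congr 1; push_cast; ring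
    obtain ⟨n, hn⟩ := exists_nat_gt (ρ.re / t)
    rw [← h2 n, Pi.zero_apply]
    refine hf _ ?_
    rw [div_lt_iff₀ ht] at hn
    have : ((n : ℂ) * t).re = n * t := by rw [← Complex.ofReal_natCast, Complex.re_ofReal_mul]; simp
    rw [Complex.sub_re, this]
    linarith

theorem poleOrder_eq_zero {ρ : ℂ} {a : ℝ × ℂ} (ha : 0 < a.1) (ha0 : 0 ≤ a.2.re) (hρ : ρ.re < 0) :
    poleOrder ρ a = 0 := by
  classical
  refine if_neg ?_
  rintro ⟨k, hk⟩
  have := congrArg Complex.re hk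
  simp only [Complex.re_ofReal_mul, Complex.add_re, Complex.natCast_re] at this
  nlinarith [mul_neg_of_pos_of_neg ha hρ, (Nat.cast_nonneg k : (0 : ℝ) ≤ k)]

/-- Both the generating series of `H` and the pole counting function of a product of Gamma factors
come from one fraction `U / G` of elements of the group algebra: the former is `2 X U / G` in power
series, the latter is `-U / G` in functions supported in a half-plane, with `U` applied to the
indicator function of `0`. -/
theorem exists_groupAlgebra_quotient (S : Multiset (ℝ × ℂ)) (hS : ∀ p ∈ S, 0 < p.1) :
    ∃ G U : AddMonoidAlgebra ℂ ℂ, InjectiveOnHalfPlane G ∧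
      toExpSeries G * (S.map hSeries).sum = 2 * PowerSeries.X * toExpSeries U ∧
      translationAction G (fun ρ => ((S.map (poleOrder ρ)).sum : ℂ)) =
        -translationAction U (Pi.single 0 1) := by
  induction S using Multiset.induction_on with
  | empty =>
    refine ⟨1, 0, fun f hf => ?_, by simp, ?_⟩
    · rw [map_one]; exact ⟨hf, id⟩
    · ext ρ
      simp
  | cons a S ih =>
    obtain ⟨G, U, h1, h2, h3⟩ := ih fun p hp => hS p (Multiset.mem_cons_of_mem hp)
    have ha : 0 < a.1 := hS a (Multiset.mem_cons_self a S)
    have ha' : (a.1 : ℂ) ≠ 0 := by exact_mod_cast ha.ne'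
    obtain ⟨g, hg⟩ : ∃ g : AddMonoidAlgebra ℂ ℂ,
        g = AddMonoidAlgebra.single (((1 / a.1 : ℝ)) : ℂ) 1 - 1 := ⟨_, rfl⟩
    obtain ⟨u, hu⟩ : ∃ u : AddMonoidAlgebra ℂ ℂ,
        u = AddMonoidAlgebra.single (a.2 / (a.1 : ℂ)) 1 := ⟨_, rfl⟩
    have hgS : toExpSeries g * hSeries a = 2 * PowerSeries.X * toExpSeries u := by
      rw [hg, hu, map_sub, map_one, toExpSeries_single, toExpSeries_single, one_smul, one_smul,
        ← hSeries_mul a ha.ne', mul_comm]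
      push_cast; rfl
    have hgP : translationAction g (fun ρ => (poleOrder ρ a : ℂ)) =
        -translationAction u (Pi.single 0 1) := by
      ext ρ
      have e1 : poleOrder (ρ - ((1 / a.1 : ℝ) : ℂ)) a = poleOrder ρ (a.1, a.2 + 1) := by
        classical
        refine if_congr (exists_congr fun k => ?_) rfl rfl
        have : (a.1 : ℂ) * (ρ - ((1 / a.1 : ℝ) : ℂ)) = a.1 * ρ - 1 := by
          push_cast; field_simp
        rw [this]
        constructor <;> intro h <;> linear_combination h
      have e2 := poleOrder_sub_one ρ ha.ne' (a.2 + 1)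
      rw [add_sub_cancel_right, Prod.mk.eta, Multiset.count_singleton] at e2
      rw [hg, hu, map_sub, map_one, LinearMap.sub_apply, Pi.sub_apply, translationAction_single,
        Pi.neg_apply, translationAction_single, e1, Module.End.one_apply, e2]
      simp only [neg_inj, Pi.single_apply, sub_eq_zero]
      split_ifs <;> simp
    refine ⟨g * G, u * G + g * U, ?_, ?_, ?_⟩
    · rw [hg]
      exact (injectiveOnHalfPlane_single_sub_one (by positivity)).mul h1
    · rw [Multiset.map_cons, Multiset.sum_cons, map_mul, map_add, map_mul, map_mul]
      linear_combination toExpSeries G * hgS + toExpSeries g * h2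
    · have e : (fun ρ => (((a ::ₘ S).map (poleOrder ρ)).sum : ℂ)) =
          (fun ρ => (poleOrder ρ a : ℂ)) + fun ρ => ((S.map (poleOrder ρ)).sum : ℂ) := by
        ext ρ; simp
      rw [e, map_add, map_add, LinearMap.add_apply, mul_comm g G, translationAction_mul, hgP,
        mul_comm G g, translationAction_mul, h3, mul_comm u G, translationAction_mul,
        translationAction_mul, map_neg, map_neg, neg_add]

theorem GammaData.poleCount_eq_zero (D : GammaData) {ρ : ℂ} (hρ : ρ.re < 0) :
    D.poleCount ρ = 0 := by
  refine Multiset.sum_eq_zero fun n hn => ?_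
  obtain ⟨a, ha, rfl⟩ := Multiset.mem_map.1 hn
  exact poleOrder_eq_zero (D.lam_pos_of_mem ha) (D.mu_re_nonneg_of_mem ha) hρ

theorem coeff_sum_hSeries (D : GammaData) (n : ℕ) :
    PowerSeries.coeff n (D.factors.map hSeries).sum = D.hInvariant n / (n.factorial : ℂ) := by
  rw [D.hInvariant_eq]
  induction D.factors using Multiset.induction_on with
  | empty => simp
  | cons a S ih =>
    simp only [Multiset.map_cons, Multiset.sum_cons, map_add, ih, add_div]
    rw [hSeries, PowerSeries.coeff_mk]

/-- The `H`-invariants determine the poles of the `γ`-factor. -/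
theorem poleCount_eq_of_hInvariant_eq {D D' : GammaData} (h : D.hInvariant = D'.hInvariant)
    (ρ : ℂ) : D.poleCount ρ = D'.poleCount ρ := by
  have hser : (D.factors.map hSeries).sum = (D'.factors.map hSeries).sum := by
    ext n; rw [coeff_sum_hSeries, coeff_sum_hSeries, h]
  obtain ⟨G, U, h1, h2, h3⟩ := exists_groupAlgebra_quotient D.factors fun p => D.lam_pos_of_mem
  obtain ⟨G', U', h1', h2', h3'⟩ :=
    exists_groupAlgebra_quotient D'.factors fun p => D'.lam_pos_of_mem
  have hX : (2 * PowerSeries.X : PowerSeries ℂ) ≠ 0 := by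
    intro h0
    have := congrArg (PowerSeries.coeff 1) h0
    rw [two_mul, map_add, PowerSeries.coeff_one_X, map_zero] at this
    norm_num at this
  have hcross : G' * U = G * U' := by
    refine toExpSeries_injective (mul_left_cancel₀ hX ?_)
    rw [hser] at h2
    rw [map_mul, map_mul]
    linear_combination toExpSeries G * h2' - toExpSeries G' * h2
  have hsupp : ∀ ρ : ℂ, ρ.re < 0 → (D.poleCount ρ : ℂ) - D'.poleCount ρ = 0 := by
    intro ρ hρ
    rw [D.poleCount_eq_zero hρ, D'.poleCount_eq_zero hρ, sub_self]
  have hzero : translationAction (G * G') (fun ρ => (D.poleCount ρ : ℂ) - D'.poleCount ρ) = 0 := by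
    have e : (fun ρ => (D.poleCount ρ : ℂ) - D'.poleCount ρ) =
        (fun ρ => ((D.factors.map (poleOrder ρ)).sum : ℂ)) -
          fun ρ => ((D'.factors.map (poleOrder ρ)).sum : ℂ) := rfl
    rw [e, map_sub, translationAction_mul G G' (fun ρ => ((D'.factors.map (poleOrder ρ)).sum : ℂ)),
      h3', mul_comm G G', translationAction_mul, h3, map_neg, map_neg,
      ← translationAction_mul, ← translationAction_mul, hcross, sub_self]
  have := congrFun (((h1.mul h1') _ hsupp).2 hzero) ρ
  exact_mod_cast sub_eq_zero.1 this

/-! ### Functional equations of the same function have the same poles -/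

theorem GammaData.gammaFactor_eq_zero_iff (D : GammaData) (s : ℂ) :
    D.gammaFactor s = 0 ↔ D.IsPole s := by
  have hQ : (D.Q : ℂ) ≠ 0 := by exact_mod_cast D.Q_pos.ne'
  simp only [gammaFactor, mul_eq_zero, Complex.cpow_eq_zero_iff, hQ, false_and, false_or,
    Finset.prod_eq_zero_iff, Finset.mem_univ, true_and, Complex.Gamma_eq_zero_iff, IsPole]

theorem GammaData.gammaFactor_ne_zero (D : GammaData) {s : ℂ} (hs : 0 < s.re) :
    D.gammaFactor s ≠ 0 := by
  rw [ne_eq, D.gammaFactor_eq_zero_iff]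
  rintro ⟨j, k, h⟩
  have := re_linear_pos (D.lam_pos j) (D.mu_re_nonneg j) hs
  rw [h] at this
  simp at this
  linarith [(Nat.cast_nonneg k : (0 : ℝ) ≤ k)]

theorem GammaData.differentiable_gammaFactor_inv (D : GammaData) :
    Differentiable ℂ fun s => (D.gammaFactor s)⁻¹ := by
  have hQ : (D.Q : ℂ) ≠ 0 := by exact_mod_cast D.Q_pos.ne'
  simp only [gammaFactor, mul_inv, ← Finset.prod_inv_distrib]
  refine Differentiable.mul (Differentiable.inv ?_ fun s => ?_) ?_
  · exact differentiable_id.const_cpow (Or.inl hQ)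
  · simp [Complex.cpow_eq_zero_iff, hQ]
  · refine Differentiable.fun_finsetProd fun j _ => ?_
    exact Complex.differentiable_one_div_Gamma.comp
      ((differentiable_id.const_mul _).add_const _)

/-- `1 / γ̄(1 - s)`, an entire function. -/
noncomputable def GammaData.dualInv (D : GammaData) (s : ℂ) : ℂ := (bar D.gammaFactor (1 - s))⁻¹

theorem GammaData.dualInv_eq (D : GammaData) (s : ℂ) :
    D.dualInv s = conj ((D.gammaFactor (conj (1 - s)))⁻¹) := by
  rw [dualInv, bar, map_inv₀]

theorem GammaData.differentiable_dualInv (D : GammaData) : Differentiable ℂ D.dualInv := by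
  have h : Differentiable ℂ fun s => conj ((D.gammaFactor (conj s))⁻¹) := fun s => by
    have := (D.differentiable_gammaFactor_inv (conj s)).conj_conj
    rwa [Complex.conj_conj] at this
  have h2 : D.dualInv = (fun s => conj ((D.gammaFactor (conj s))⁻¹)) ∘ fun s => 1 - s :=
    funext D.dualInv_eq
  rw [h2]
  exact h.comp ((differentiable_const 1).sub differentiable_id)

theorem GammaData.dualInv_ne_zero (D : GammaData) {s : ℂ} (hs : s.re < 1) : D.dualInv s ≠ 0 := by
  rw [D.dualInv_eq, ne_eq, map_eq_zero]
  exact inv_ne_zero (D.gammaFactor_ne_zero (by simpa using hs))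

theorem eventually_ne_zero_of_differentiable {f : ℂ → ℂ} (hf : Differentiable ℂ f) {w : ℂ}
    (hw : f w ≠ 0) (z : ℂ) : ∀ᶠ s in 𝓝[≠] z, f s ≠ 0 := by
  refine (hf.analyticAt z).eventually_eq_zero_or_eventually_ne_zero.resolve_left fun h => hw ?_
  have := (hf.differentiableOn.analyticOnNhd isOpen_univ).eq_of_eventuallyEq (g := fun _ => 0)
    (fun _ _ => analyticAt_const) (z₀ := z) h
  exact congrFun this w

theorem IsExtendedSelberg.eventually_ne_zero {F : ℂ → ℂ} (hF : IsExtendedSelberg F) (z : ℂ) :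
    ∀ᶠ s in 𝓝[≠] z, F s ≠ 0 := by
  obtain ⟨m, G, hG, -, h⟩ := hF.continuation
  obtain ⟨w, hw, hFw⟩ := hF.ne_zero
  have hw1 : w ≠ 1 := by rintro rfl; simp at hw
  have hGw : (w - 1) * G w ≠ 0 := by
    rw [← h w hw1]
    exact mul_ne_zero (sub_ne_zero.2 hw1) (mul_ne_zero (pow_ne_zero _ (sub_ne_zero.2 hw1)) hFw)
  have hd : Differentiable ℂ fun s => (s - 1) * G s := (differentiable_id.sub_const 1).mul hG
  filter_upwards [eventually_ne_zero_of_differentiable hd hGw z] with s hs hs0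
  have hs1 : s ≠ 1 := by rintro rfl; simp at hs
  rw [← h s hs1, hs0] at hs
  simp at hs

/-- Two functional equations of the same `F`: dividing them eliminates `F`. Written for the
reciprocals of the `γ`-factors, the result is an identity of entire functions. -/
theorem functionalEquation_quotient {F : ℂ → ℂ} (hF : IsExtendedSelberg F) {D D' : GammaData}
    (h : FunctionalEquation F D) (h' : FunctionalEquation F D') (s : ℂ) :
    (D'.gammaFactor s)⁻¹ * (D'.ω * D.dualInv s) = (D.gammaFactor s)⁻¹ * (D.ω * D'.dualInv s) := by
  have key : ∀ᶠ s in 𝓝[≠] (2 : ℂ), (D'.gammaFactor s)⁻¹ * (D'.ω * D.dualInv s) =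
      (D.gammaFactor s)⁻¹ * (D.ω * D'.dualInv s) := by
    have e0 : (0 : ℂ).re < 1 := by simp
    have hnear : ∀ᶠ s : ℂ in 𝓝[≠] (2 : ℂ), 1 < s.re :=
      mem_nhdsWithin_of_mem_nhds ((isOpen_lt continuous_const Complex.continuous_re).mem_nhds
        (by simp))
    filter_upwards [hnear, hF.eventually_ne_zero 2,
      eventually_ne_zero_of_differentiable D.differentiable_dualInv (D.dualInv_ne_zero e0) 2,
      eventually_ne_zero_of_differentiable D'.differentiable_dualInv (D'.dualInv_ne_zero e0) 2]
      with s hs hFs hk hk'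
    have hs0 : s ≠ 0 := by rintro rfl; simp at hs; linarith
    have hs1 : s ≠ 1 := by rintro rfl; simp at hs
    have hg := D.gammaFactor_ne_zero (by linarith : 0 < s.re)
    have hg' := D'.gammaFactor_ne_zero (by linarith : 0 < s.re)
    have np : ∀ E : GammaData, E.dualInv s ≠ 0 → ¬ E.IsPole (conj (1 - s)) := by
      intro E hE
      rw [← E.gammaFactor_eq_zero_iff]
      intro h0
      exact hE (by rw [E.dualInv_eq, h0]; simp)
    have f1 := h s hs0 hs1 (by rwa [← D.gammaFactor_eq_zero_iff]) (np D hk)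
    have f2 := h' s hs0 hs1 (by rwa [← D'.gammaFactor_eq_zero_iff]) (np D' hk')
    unfold GammaData.dualInv at hk hk' ⊢
    have hb : bar D.gammaFactor (1 - s) ≠ 0 := fun h0 => hk (by rw [h0, inv_zero])
    have hb' : bar D'.gammaFactor (1 - s) ≠ 0 := fun h0 => hk' (by rw [h0, inv_zero])
    have hbF : bar F (1 - s) ≠ 0 := by
      intro h0
      rw [h0, mul_zero] at f1
      exact mul_ne_zero hg hFs f1
    field_simp
    refine mul_right_cancel₀ (mul_ne_zero hFs hbF) ?_
    linear_combination (D'.ω * bar D'.gammaFactor (1 - s) * bar F (1 - s)) * f1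
      - (D.ω * bar D.gammaFactor (1 - s) * bar F (1 - s)) * f2
  have d1 : Differentiable ℂ fun s => (D'.gammaFactor s)⁻¹ * (D'.ω * D.dualInv s) :=
    D'.differentiable_gammaFactor_inv.mul (D.differentiable_dualInv.const_mul _)
  have d2 : Differentiable ℂ fun s => (D.gammaFactor s)⁻¹ * (D.ω * D'.dualInv s) :=
    D.differentiable_gammaFactor_inv.mul (D'.differentiable_dualInv.const_mul _)
  exact congrFun ((d1.differentiableOn.analyticOnNhd isOpen_univ).eq_of_frequently_eq
    (d2.differentiableOn.analyticOnNhd isOpen_univ) key.frequently) s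

open Classical in
/-- `1 / Γ` has a simple zero at each pole of `Γ`. -/
theorem analyticOrderAt_Gamma_inv (z : ℂ) : analyticOrderAt (fun s => (Complex.Gamma s)⁻¹) z =
    ((if ∃ k : ℕ, z = -(k : ℂ) then 1 else 0 : ℕ) : ℕ∞) := by
  have han : ∀ z, AnalyticAt ℂ (fun s => (Complex.Gamma s)⁻¹) z := fun z =>
    Complex.differentiable_one_div_Gamma.analyticAt z
  split_ifs with h
  · obtain ⟨k, rfl⟩ := h
    have hrec : (fun s => (Complex.Gamma s)⁻¹) =
        id * ((fun s => (Complex.Gamma s)⁻¹) ∘ fun s => s + 1) :=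
      funext fun s => Complex.one_div_Gamma_eq_self_mul_one_div_Gamma_add_one s
    have hcomp : ∀ z, AnalyticAt ℂ ((fun s => (Complex.Gamma s)⁻¹) ∘ fun s : ℂ => s + 1) z :=
      fun z => (han _).comp (f := fun s : ℂ => s + 1) (by fun_prop)
    induction k with
    | zero =>
      rw [hrec, analyticOrderAt_mul analyticAt_id (hcomp _)]
      simp only [Nat.cast_zero, neg_zero]
      rw [analyticOrderAt_id, (hcomp 0).analyticOrderAt_eq_zero.2 (by simp)]
      simp
    | succ k ih =>
      rw [hrec, analyticOrderAt_mul analyticAt_id (hcomp _),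
        analyticOrderAt_comp_of_deriv_ne_zero (by fun_prop) (by simp),
        (analyticAt_id (𝕜 := ℂ)).analyticOrderAt_eq_zero.2 (by
          simp only [id]; exact neg_ne_zero.2 (by exact_mod_cast k.succ_ne_zero)), zero_add, ← ih]
      congr 1
      push_cast; ring
  · rw [(han z).analyticOrderAt_eq_zero.2]
    · simp
    · refine inv_ne_zero ?_
      rwa [ne_eq, Complex.Gamma_eq_zero_iff]

theorem analyticOrderAt_prod_Gamma_inv (S : Multiset (ℝ × ℂ)) (hS : ∀ p ∈ S, 0 < p.1) (z : ℂ) :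
    AnalyticAt ℂ (fun s => (S.map fun p => (Complex.Gamma ((p.1 : ℂ) * s + p.2))⁻¹).prod) z ∧
    analyticOrderAt (fun s => (S.map fun p => (Complex.Gamma ((p.1 : ℂ) * s + p.2))⁻¹).prod) z =
      ((S.map (poleOrder (-z))).sum : ℕ∞) := by
  classical
  induction S using Multiset.induction_on with
  | empty =>
    simp only [Multiset.map_zero, Multiset.prod_zero, Multiset.sum_zero, Nat.cast_zero]
    exact ⟨analyticAt_const, analyticAt_const.analyticOrderAt_eq_zero.2 one_ne_zero⟩
  | cons a S ih =>
    obtain ⟨h1, h2⟩ := ih fun p hp => hS p (Multiset.mem_cons_of_mem hp)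
    have ha : (a.1 : ℂ) ≠ 0 := by exact_mod_cast (hS a (Multiset.mem_cons_self a S)).ne'
    simp only [Multiset.map_cons, Multiset.prod_cons, Multiset.sum_cons]
    have hlin : AnalyticAt ℂ (fun s : ℂ => (a.1 : ℂ) * s + a.2) z := by fun_prop
    have h3 : AnalyticAt ℂ ((fun s => (Complex.Gamma s)⁻¹) ∘ fun s : ℂ => (a.1 : ℂ) * s + a.2) z :=
      (Complex.differentiable_one_div_Gamma.analyticAt _).comp hlin
    have h4 : deriv (fun s : ℂ => (a.1 : ℂ) * s + a.2) z ≠ 0 := by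
      have : HasDerivAt (fun s : ℂ => (a.1 : ℂ) * s + a.2) (a.1 * 1) z :=
        ((hasDerivAt_id z).const_mul _).add_const _
      rw [this.deriv, mul_one]; exact ha
    refine ⟨h3.mul h1, ?_⟩
    have h5 := analyticOrderAt_mul h3 h1
    rw [analyticOrderAt_comp_of_deriv_ne_zero hlin h4, h2, analyticOrderAt_Gamma_inv] at h5
    have h6 : (∃ k : ℕ, (a.1 : ℂ) * z + a.2 = -k) ↔ ∃ k : ℕ, (a.1 : ℂ) * -z = a.2 + k :=
      exists_congr fun k => by constructor <;> intro h <;> linear_combination -h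
    rw [if_congr h6 rfl rfl] at h5
    refine Eq.trans h5 ?_
    rw [Nat.cast_add]
    rfl

theorem GammaData.analyticOrderAt_gammaFactor_inv (D : GammaData) (z : ℂ) :
    analyticOrderAt (fun s => (D.gammaFactor s)⁻¹) z = (D.poleCount (-z) : ℕ∞) := by
  have hQ : (D.Q : ℂ) ≠ 0 := by exact_mod_cast D.Q_pos.ne'
  have e : (fun s => (D.gammaFactor s)⁻¹) = (fun s : ℂ => ((D.Q : ℂ) ^ s)⁻¹) *
      fun s : ℂ => (D.factors.map fun p => (Complex.Gamma ((p.1 : ℂ) * s + p.2))⁻¹).prod := by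
    ext s
    rw [D.gammaFactor_eq, mul_inv, Pi.mul_apply, Multiset.prod_map_inv]
  have hd : Differentiable ℂ fun s : ℂ => ((D.Q : ℂ) ^ s)⁻¹ := by
    refine Differentiable.inv ?_ fun s => by simp [Complex.cpow_eq_zero_iff, hQ]
    exact differentiable_id.const_cpow (Or.inl hQ)
  obtain ⟨h1, h2⟩ := analyticOrderAt_prod_Gamma_inv D.factors (fun p => D.lam_pos_of_mem) z
  rw [e, analyticOrderAt_mul (hd.analyticAt z) h1, h2,
    (hd.analyticAt z).analyticOrderAt_eq_zero.2 (by simp [Complex.cpow_eq_zero_iff, hQ]), zero_add]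
  rfl

/-- The poles of the `γ`-factor depend on `F` only: in `Re s ≤ 0`, where all of them lie, the other
side of the quotient of the two functional equations has neither zeros nor poles. -/
theorem poleCount_eq_of_functionalEquation {F : ℂ → ℂ} (hF : IsExtendedSelberg F) {D D' : GammaData}
    (h : FunctionalEquation F D) (h' : FunctionalEquation F D') (ρ : ℂ) (hρ : 0 ≤ ρ.re) :
    D.poleCount ρ = D'.poleCount ρ := by
  have hω : ∀ E : GammaData, E.ω ≠ 0 := fun E =>
    norm_ne_zero_iff.1 (by rw [E.norm_ω]; exact one_ne_zero)
  have hre : (-ρ).re < 1 := by simp only [Complex.neg_re]; linarith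
  have ho : ∀ E E' : GammaData, analyticOrderAt
      (fun s => (E.gammaFactor s)⁻¹ * (E.ω * E'.dualInv s)) (-ρ) = (E.poleCount ρ : ℕ∞) := by
    intro E E'
    have hd : Differentiable ℂ fun s => E.ω * E'.dualInv s := E'.differentiable_dualInv.const_mul _
    have := analyticOrderAt_mul
      (E.differentiable_gammaFactor_inv.analyticAt (-ρ)) (hd.analyticAt (-ρ))
    rw [(hd.analyticAt (-ρ)).analyticOrderAt_eq_zero.2
      (mul_ne_zero (hω E) (E'.dualInv_ne_zero hre)), add_zero,
      E.analyticOrderAt_gammaFactor_inv, neg_neg] at this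
    exact this
  have e := ho D' D
  rw [funext (functionalEquation_quotient hF h h'), ho D D'] at e
  exact_mod_cast e

/-! ### Invariants and stable rational extensions -/

/-- A function stable under the multiplication formula does not depend on the order of the Gamma
factors: for `m = 1` the formula only permutes them. -/
theorem StableMultiplication.eq_of_factors_eq {Istar : RatFunc ℂ → GammaData → ℂ}
    (hm : StableMultiplication Istar) {R : RatFunc ℂ} (hR : R ≠ 0) {D D' : GammaData}
    (hω : D.ω = D'.ω) (hQ : D.Q = D'.Q) (hf : D.factors = D'.factors) : Istar R D = Istar R D' := by
  rcases Multiset.empty_or_exists_mem D.factors with h0 | ⟨a, ha⟩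
  · have hr : D.r = 0 := by simpa [GammaData.factors] using congrArg Multiset.card h0
    have hr' : D'.r = 0 := by
      simpa [GammaData.factors] using congrArg Multiset.card (hf.symm.trans h0)
    obtain ⟨ω, Q, r, lam, mu, _, _, _, _⟩ := D
    obtain ⟨ω', Q', r', lam', mu', _, _, _, _⟩ := D'
    simp only at hω hQ hr hr'
    subst hω hQ hr hr'
    obtain rfl : lam = lam' := funext fun j => j.elim0
    obtain rfl : mu = mu' := funext fun j => j.elim0
    rfl
  · obtain ⟨S, hS⟩ := Multiset.exists_cons_of_mem ha
    refine hm R hR D D' ⟨1, a.1, a.2, S, 1, le_rfl, hS, ?_, by simp, by simp [hQ], by simp [hω]⟩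
    rw [← hf, hS]
    simp

/-- If data with the same Gamma factors and the same `Q` arise by reduction from `D` and `D'`, then
`γ_D` is a constant multiple of `γ_{D'}`, up to the factor `(Q_E / Q_{E'}) ^ s`. -/
theorem gammaFactor_eq_of_reduces {D D' E E' : GammaData} {p p' : Polynomial ℂ} {κ : ℝ} (hκ : 0 < κ)
    (hE : Reduces D p E) (hE' : Reduces D' p' E') (hf : E.factors = E'.factors)
    (hp : p = Polynomial.C (κ : ℂ) * p') :
    ∃ C : ℂ, C ≠ 0 ∧ (E.ω = E'.ω ↔ D'.ω * C = D.ω * conj C) ∧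
      ∀ s : ℂ, 0 < s.re →
        D.gammaFactor s = C * ((E.Q / E'.Q : ℝ) : ℂ) ^ s * D'.gammaFactor s := by
  obtain ⟨c, hc, hω, hs⟩ := hE.gammaFactor_eq
  obtain ⟨c', hc', hω', hs'⟩ := hE'.gammaFactor_eq
  have hκ' : (κ : ℂ) ≠ 0 := by exact_mod_cast hκ.ne'
  have hcc : conj c ≠ 0 := (map_ne_zero _).2 hc
  have hcc' : conj c' ≠ 0 := (map_ne_zero _).2 hc'
  refine ⟨c * κ / c', div_ne_zero (mul_ne_zero hc hκ') hc', ?_, fun s h => ?_⟩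
  · rw [hω, hω', map_div₀, map_mul, Complex.conj_ofReal]
    field_simp
    constructor <;> intro h <;> linear_combination -h
  · have hQ : (E.Q : ℂ) ^ s = ((E.Q / E'.Q : ℝ) : ℂ) ^ s * (E'.Q : ℂ) ^ s := by
      rw [← Complex.mul_cpow_ofReal_nonneg (div_nonneg E.Q_pos.le E'.Q_pos.le) E'.Q_pos.le,
        ← Complex.ofReal_mul, div_mul_cancel₀ _ E'.Q_pos.ne']
    rw [hs s h, hs' s h, E.gammaFactor_eq, E'.gammaFactor_eq, hf, hQ, hp, Polynomial.eval_mul,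
      Polynomial.eval_C]
    generalize (Multiset.map (fun q : ℝ × ℂ => Complex.Gamma ((q.1 : ℂ) * s + q.2))
      E'.factors).prod = P
    field_simp

/-- Two data of the same `F` are connected by reductions to data which agree up to the order of the
factors. -/
theorem exists_reduction_of_functionalEquation {F : ℂ → ℂ} (hF : IsExtendedSelberg F)
    {D D' : GammaData} (h : FunctionalEquation F D) (h' : FunctionalEquation F D') :
    ∃ (p p' : Polynomial ℂ) (E E' : GammaData) (κ : ℝ), 0 < κ ∧ Reduces D p E ∧ Reduces D' p' E' ∧
      E.factors = E'.factors ∧ p = Polynomial.C (κ : ℂ) * p' ∧ E.Q = E'.Q ∧ E.ω = E'.ω := by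
  obtain ⟨p, p', E, E', κ, hκ, hE, hE', hf, hp⟩ := exists_common_reduction (D := D) (D' := D')
    (by
      intro ρ
      rcases lt_or_ge ρ.re 0 with hρ | hρ
      · rw [D.poleCount_eq_zero hρ, D'.poleCount_eq_zero hρ]
      · exact poleCount_eq_of_functionalEquation hF h h' ρ hρ)
  obtain ⟨C, hC, hω, hs⟩ := gammaFactor_eq_of_reduces hκ hE hE' hf hp
  have ha : 0 < E.Q / E'.Q := div_pos E.Q_pos E'.Q_pos
  obtain ⟨a, ha'⟩ : ∃ a, a = E.Q / E'.Q := ⟨_, rfl⟩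
  rw [← ha'] at hs ha
  have hCc : conj C ≠ 0 := (map_ne_zero _).2 hC
  -- On `0 < s < 1` the functional equations give `ω' C a^s = ω C̄ a^(1-s)`.
  have key : ∀ x : ℝ, 0 < x → x < 1 →
      D'.ω * C * ((a ^ x : ℝ) : ℂ) = D.ω * conj C * ((a ^ (1 - x) : ℝ) : ℂ) := by
    intro x h0 h1
    have hq := functionalEquation_quotient hF h h' (x : ℂ)
    have hxc : conj (1 - (x : ℂ)) = ((1 - x : ℝ) : ℂ) := by
      rw [← Complex.ofReal_one, ← Complex.ofReal_sub, Complex.conj_ofReal]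
    have e1 := hs (x : ℂ) (by simpa using h0)
    have e2 := hs ((1 - x : ℝ) : ℂ) (by simpa using h1)
    have n1 := D'.gammaFactor_ne_zero (s := (x : ℂ)) (by simpa using h0)
    have n2 := D'.gammaFactor_ne_zero (s := ((1 - x : ℝ) : ℂ)) (by simpa using h1)
    rw [← Complex.ofReal_cpow ha.le] at e1 e2
    have p1 : ((a ^ x : ℝ) : ℂ) ≠ 0 := by exact_mod_cast (Real.rpow_pos_of_pos ha x).ne'
    have p2 : ((a ^ (1 - x) : ℝ) : ℂ) ≠ 0 := by exact_mod_cast (Real.rpow_pos_of_pos ha (1 - x)).ne'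
    have n3 : conj (D'.gammaFactor ((1 - x : ℝ) : ℂ)) ≠ 0 := (map_ne_zero _).2 n2
    rw [GammaData.dualInv_eq, GammaData.dualInv_eq, hxc, e1, e2, map_inv₀, map_inv₀, map_mul,
      map_mul, Complex.conj_ofReal] at hq
    field_simp at hq
    linear_combination hq
  have hωC : D'.ω * C = D.ω * conj C := by
    have := key (1 / 2) (by norm_num) (by norm_num)
    rw [show (1 - 1 / 2 : ℝ) = 1 / 2 by norm_num] at this
    exact mul_right_cancel₀ (by exact_mod_cast (Real.rpow_pos_of_pos ha _).ne') this
  have ha1 : a = 1 := by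
    have h4 := key (1 / 4) (by norm_num) (by norm_num)
    have hne : D.ω * conj C ≠ 0 :=
      mul_ne_zero (norm_ne_zero_iff.1 (by rw [D.norm_ω]; exact one_ne_zero)) hCc
    rw [hωC] at h4
    have h5 : a ^ (1 / 4 : ℝ) = a ^ (1 - 1 / 4 : ℝ) := by exact_mod_cast mul_left_cancel₀ hne h4
    by_contra hne1
    have := (Real.rpow_right_inj ha hne1).1 h5
    norm_num at this
  exact ⟨p, p', E, E', κ, hκ, hE, hE', hf, hp,
    (div_eq_one_iff_eq E'.Q_pos.ne').1 (ha'.symm.trans ha1),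
    hω.2 hωC⟩

theorem isInvariant_of_stable {I : SelbergData → ℂ} {Istar : RatFunc ℂ → GammaData → ℂ}
    (hI : IsRationalExtension Istar I) (hm : StableMultiplication Istar)
    (hf : StableFactorial Istar) : IsInvariant I := by
  intro F hF D D' h h'
  obtain ⟨p, p', E, E', κ, hκ, hE, hE', hfac, hp, hQ, hω⟩ :=
    exists_reduction_of_functionalEquation hF h h'
  have hκ' : (κ : ℂ) ≠ 0 := by exact_mod_cast hκ.ne'
  rw [← hI 1 one_ne_zero D, ← hI κ hκ' D', hE.stable_eq hm hf one_ne_zero, hE'.stable_eq hm hf hκ',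
    hp, map_mul (algebraMap _ _), RatFunc.algebraMap_C, map_one, one_mul]
  exact hm.eq_of_factors_eq (C_mul_algebraMap_ne_zero hκ' hE'.ne_zero) hω hQ hfac

/-- The root number, the conductor and the `H`-invariants determine the functional equation. -/
theorem functionalEquation_of_invariants_eq {F : ℂ → ℂ} {D D' : GammaData}
    (h : FunctionalEquation F D) (hroot : D.rootNumber = D'.rootNumber)
    (hcond : D.conductor = D'.conductor) (hH : D.hInvariant = D'.hInvariant) :
    FunctionalEquation F D' := by
  obtain ⟨p, p', E, E', κ, hκ, hE, hE', hf, hp⟩ :=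
    exists_common_reduction (poleCount_eq_of_hInvariant_eq hH)
  have hQ : E.Q = E'.Q := by
    have e := hE.conductor_eq.symm.trans (hcond.trans hE'.conductor_eq)
    rw [E.conductor_eq, E'.conductor_eq, hf] at e
    have h1 : (E'.factors.map fun p => p.1 ^ (2 * p.1)).prod ≠ 0 := by
      refine Multiset.prod_ne_zero fun h0 => ?_
      obtain ⟨q, hq, h0⟩ := Multiset.mem_map.1 h0
      exact (Real.rpow_pos_of_pos (E'.lam_pos_of_mem hq) _).ne' h0
    have h2 : (2 * Real.pi) ^ (2 * (E'.factors.map Prod.fst).sum) ≠ 0 :=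
      (Real.rpow_pos_of_pos Real.two_pi_pos _).ne'
    exact (pow_left_inj₀ E.Q_pos.le E'.Q_pos.le two_ne_zero).1
      (mul_left_cancel₀ h2 (mul_right_cancel₀ h1 e))
  have hω : E.ω = E'.ω := by
    have e := hE.rootNumber_eq.symm.trans (hroot.trans hE'.rootNumber_eq)
    rw [E.rootNumber_eq, E'.rootNumber_eq, hf] at e
    refine mul_right_cancel₀ (Multiset.prod_ne_zero fun h0 => ?_) e
    obtain ⟨q, hq, h0⟩ := Multiset.mem_map.1 h0
    rw [Complex.cpow_eq_zero_iff] at h0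
    exact (E'.lam_pos_of_mem hq).ne' (by exact_mod_cast h0.1)
  obtain ⟨C, hC, hω', hs⟩ := gammaFactor_eq_of_reduces hκ hE hE' hf hp
  have hωC := hω'.1 hω
  rw [hQ, div_self E'.Q_pos.ne'] at hs
  simp only [Complex.ofReal_one, Complex.one_cpow, mul_one] at hs
  -- `γ_D = C γ_{D'}` everywhere, by the identity theorem for the entire functions `1 / γ`.
  have hall : ∀ s, D.gammaFactor s = C * D'.gammaFactor s := by
    have e : (fun s => C * (D.gammaFactor s)⁻¹) = fun s => (D'.gammaFactor s)⁻¹ := by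
      refine ((D.differentiable_gammaFactor_inv.const_mul C).differentiableOn.analyticOnNhd
        isOpen_univ).eq_of_eventuallyEq
        (D'.differentiable_gammaFactor_inv.differentiableOn.analyticOnNhd isOpen_univ) (z₀ := 1) ?_
      filter_upwards [(isOpen_lt continuous_const Complex.continuous_re).mem_nhds
        (show (0 : ℝ) < (1 : ℂ).re by simp)] with s h0
      rw [hs s h0, mul_inv, mul_inv_cancel_left₀ hC]
    intro s
    have := congrFun e s
    rw [← inv_inj, mul_inv, ← this, inv_mul_cancel_left₀ hC]
  intro s h0 h1 hp1 hp2
  have hpole : ∀ z, D.IsPole z ↔ D'.IsPole z := fun z => by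
    rw [← D.gammaFactor_eq_zero_iff, ← D'.gammaFactor_eq_zero_iff, hall z]
    simp [hC]
  have key := h s h0 h1 (by rwa [hpole]) (by rwa [hpole])
  have hbar : bar D.gammaFactor (1 - s) = conj C * bar D'.gammaFactor (1 - s) := by
    simp only [bar, hall, map_mul]
  rw [hall, hbar] at key
  refine mul_left_cancel₀ hC ?_
  linear_combination key - bar D'.gammaFactor (1 - s) * bar F (1 - s) * hωC

open Classical in
/-- The invariant `I` as a function of the root number, the conductor and the `H`-invariants; the
value `0` is taken where no data of a functional equation have the given invariants. -/
noncomputable def invariantFunction (I : SelbergData → ℂ) (w : ℂ) (q : ℝ) (H : ℕ → ℂ) : ℂ :=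
  if h : ∃ D : SelbergData, D.1.rootNumber = w ∧ D.1.conductor = q ∧ D.1.hInvariant = H then
    I h.choose else 0

theorem IsInvariant.eq_invariantFunction {I : SelbergData → ℂ} (hI : IsInvariant I)
    (D : SelbergData) :
    I D = invariantFunction I D.1.rootNumber D.1.conductor D.1.hInvariant := by
  have h : ∃ D' : SelbergData, D'.1.rootNumber = D.1.rootNumber ∧ D'.1.conductor = D.1.conductor ∧
      D'.1.hInvariant = D.1.hInvariant := ⟨D, rfl, rfl, rfl⟩
  rw [invariantFunction, dif_pos h]
  obtain ⟨h1, h2, h3⟩ := h.choose_spec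
  obtain ⟨F, hF, hFD⟩ := D.2
  exact hI F hF D _ hFD (functionalEquation_of_invariants_eq hFD h1.symm h2.symm h3.symm)

theorem stableMultiplication_of_invariants (J : ℂ → ℝ → (ℕ → ℂ) → ℂ) :
    StableMultiplication fun R D => J D.rootNumber D.conductor (hStar R D) := by
  intro R _ D D' h
  simp only [h.rootNumber_eq, h.conductor_eq, h.hStar_eq R]

theorem stableFactorial_of_invariants (J : ℂ → ℝ → (ℕ → ℂ) → ℂ) :
    StableFactorial fun R D => J D.rootNumber D.conductor (hStar R D) := by
  rintro R R' hR hR' D D' (h | h)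
  · simp only [h.rootNumber_eq, h.conductor_eq, h.hStar_eq hR]
  · have h := h.expandingStep
    simp only [h.rootNumber_eq, h.conductor_eq, h.hStar_eq hR']

end ExtSelberg

theorem mainTheorem1 (I : ExtSelberg.SelbergData → ℂ) :
    (ExtSelberg.IsInvariant I ↔
      ∃ Istar : RatFunc ℂ → ExtSelberg.GammaData → ℂ,
        ExtSelberg.IsRationalExtension Istar I ∧
        ExtSelberg.StableMultiplication Istar ∧
        ExtSelberg.StableFactorial Istar) ∧
    (ExtSelberg.IsInvariant I →
      ∃ Itilde : ℂ → ℝ → (ℕ → ℂ) → ℂ,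
        (∀ D : ExtSelberg.SelbergData,
          I D = Itilde D.1.rootNumber D.1.conductor D.1.hInvariant) ∧
        ExtSelberg.IsRationalExtension
          (fun R D => Itilde D.rootNumber D.conductor (ExtSelberg.hStar R D)) I ∧
        ExtSelberg.StableMultiplication
          (fun R D => Itilde D.rootNumber D.conductor (ExtSelberg.hStar R D)) ∧
        ExtSelberg.StableFactorial
          (fun R D => Itilde D.rootNumber D.conductor (ExtSelberg.hStar R D))) := by
  have explicit : ExtSelberg.IsInvariant I →
      ∃ Itilde : ℂ → ℝ → (ℕ → ℂ) → ℂ,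
        (∀ D : ExtSelberg.SelbergData,
          I D = Itilde D.1.rootNumber D.1.conductor D.1.hInvariant) ∧
        ExtSelberg.IsRationalExtension
          (fun R D => Itilde D.rootNumber D.conductor (ExtSelberg.hStar R D)) I ∧
        ExtSelberg.StableMultiplication
          (fun R D => Itilde D.rootNumber D.conductor (ExtSelberg.hStar R D)) ∧
        ExtSelberg.StableFactorial
          (fun R D => Itilde D.rootNumber D.conductor (ExtSelberg.hStar R D)) := fun hI =>
    ⟨ExtSelberg.invariantFunction I, hI.eq_invariantFunction,
      fun κ _ D => by simp only [ExtSelberg.hStar_C, hI.eq_invariantFunction D],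
      ExtSelberg.stableMultiplication_of_invariants _, ExtSelberg.stableFactorial_of_invariants _⟩
  refine ⟨⟨fun hI => ?_, ?_⟩, explicit⟩
  · obtain ⟨J, -, h⟩ := explicit hI
    exact ⟨_, h⟩
  · rintro ⟨Istar, h1, h2, h3⟩
    exact ExtSelberg.isInvariant_of_stable h1 h2 h3
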